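/- **Setting.** A $k$-dimensional *resolution configuration* $C$ consists of finitely many disjoint smooth circles in $S^2$ (the *starting circles*) and $k$ disjoint smoothly embedded oriented arcs, whose endpoints lie on the circles (met transversally there) and whose interiors are disjoint from the circles; $C$ may be disconnected. Surgery on the starting circles along all the arcs produces the *ending circles*. Let $V_0(C)=\bigotimes_x\mathbb F_2[x]/(x^2)$ over the starting circles $x$, and $V_1(C)=\bigotimes_y\mathbb F_2[y]/(y^2)$ over the ending circles $y$; both have a basis of monomials. In $V_0(C)$ put $\mathrm{gr}_q(1)=1$ and $\mathrm{gr}_q(x)=-1$ for each tensor factor; in $V_1(C)$ do the same and then raise $\mathrm{gr}_q$ by $k$; the homological degree $\mathrm{gr}_h$ of $V_1(C)$ is $k$ higher than that of $V_0(C)$. A circle disjoint from all arcs is *passive*. Removing the passive circles gives the *active part* $C_0$. With $P(C)=\bigotimes_w\mathbb F_2[w]/(w^2)$ over the passive circles $w$, one has $V_i(C)=V_i(C_0)\otimes P(C)$ for $i=0,1$. A connected $n$-dimensional configuration is a *tree* if it has $n+1$ starting circles and one ending circle, and a *dual tree* (dual of a tree) if it has one starting circle and $n+1$ ending circles. **Rules.**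 Let $F=\{F_C\}$ be a family of $\mathbb F_2$-linear maps $F_C:V_0(C)\to V_1(C)$, one for each $k$-dimensional resolution configuration $C$. * *Naturality:* if an orientation-preserving diffeomorphism of $S^2$ sends $C$ to $C'$, then $F_C=F_{C'}$ under the induced identifications. * *Disoriented:* $F_C$ does not depend on the orientations of the arcs. * *Duality:* let $C^*$ be the dual configuration (its starting circles are the ending circles of $C$, its arcs are the arcs of $C$ rotated by $90^\circ$ counterclockwise) and $m(C^*)$ its mirror image, so that $V_0(C)=V_1(m(C^*))$ and $V_1(C)=V_0(m(C^*))$. For monomials $a\in V_0(C)$, $b\in V_1(C)$, the coefficient of $F_C(a)$ at $b$ equals that of $F_{m(C^*)}(b^*)$ at $a^*$, where $*$ exchanges $1$ and the generator in every tensor factor. * *Extension:* $F_C(a\cdot v)=F_{C_0}(a)\cdot v$ for $a\in V_0(C_0)$ and $v\in P(C)$. * *Filtration:* for a point $P$ of the starting circles that also lies on an ending circle, let $x(P)$ and $y(P)$ be the starting and the ending circle containing $P$. If $x(P)$ divides the monomial $a$ and the coefficient of $F_C(a)$ at the monomial $b$ is non-zero, then $y(P)$ divides $b$. **Theorem.**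 Let $k\ge 0$ and let $F=\{F_C\}$ be such a family of bidegree $(\mathrm{gr}_h,\mathrm{gr}_q)=(k,2k)$ satisfying the naturality, disoriented, duality, extension and filtration rules. Let $C$ be a $k$-dimensional resolution configuration, possibly disconnected, with $F_C\neq 0$. Then the active part $C_0$ is a disjoint union of trees and dual trees, and $F_C$ is given by the Sarkar–Seed–Szabo formula $$F_C=\Big(\bigotimes_{T} F_T\Big)\otimes \mathrm{id}_{P(C)},$$ where $T$ runs over the connected components of $C_0$. If $T$ is a tree with starting circles $x_1,\dots,x_{n+1}$ and ending circle $y$, then $F_T(x_1\cdots x_{n+1})=y$ and $F_T$ is zero on all other monomials. If $T$ is a dual tree, then $F_T(1)=1\otimes\cdots\otimes1$ and $F_T$ is zero on all other monomials. -/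

import Mathlib

open scoped Manifold ContDiff

/-! ### The sphere, smooth curves in it, diffeomorphisms -/

/-- The two-sphere: the unit sphere of Euclidean three-space. -/
abbrev Sphere2 : Type := Metric.sphere (0 : EuclideanSpace ℝ (Fin 3)) 1

/-- The determinant of three vectors of `ℝ³`. For `p` on the sphere and `u, v` tangent at `p`, its
sign says whether `(u, v)` is a positive frame of the tangent plane (oriented by the outward
normal), that is, whether `v` points to the left of `u`. -/
noncomputable def det3 (p u v : EuclideanSpace ℝ (Fin 3)) : ℝ :=
  Matrix.det (Matrix.of ![⇑p, ⇑u, ⇑v])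

/-- A curve in the sphere is smooth if it is smooth as a curve in `ℝ³`. -/
def SmoothCurve (f : ℝ → Sphere2) : Prop :=
  ContDiff ℝ ∞ (fun t => (f t : EuclideanSpace ℝ (Fin 3)))

/-- The velocity vector of a curve in the sphere. -/
noncomputable def velocity (f : ℝ → Sphere2) (t : ℝ) : EuclideanSpace ℝ (Fin 3) :=
  deriv (fun t => (f t : EuclideanSpace ℝ (Fin 3))) t

/-- `f` is a regular smooth `1`-periodic parametrization of the embedded circle `c`. -/
structure IsCircleParam (c : Set Sphere2) (f : ℝ → Sphere2) : Prop where
  smooth : SmoothCurve f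
  periodic : Function.Periodic f 1
  injOn : Set.InjOn f (Set.Ico 0 1)
  regular : ∀ t, velocity f t ≠ 0
  range_eq : Set.range f = c

/-- An oriented arc, recorded as a subset of the sphere with its initial and its final point. -/
@[ext]
structure OrientedArc where
  carrier : Set Sphere2
  src : Sphere2
  tgt : Sphere2

/-- `γ`, restricted to `[0, 1]`, is a regular smooth parametrization of the embedded arc `A`,
compatible with its orientation. -/
structure IsArcParam (A : OrientedArc) (γ : ℝ → Sphere2) : Prop where
  smooth : SmoothCurve γ
  injOn : Set.InjOn γ (Set.Icc 0 1)
  regular : ∀ t ∈ Set.Icc (0 : ℝ) 1, velocity γ t ≠ 0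
  image_eq : γ '' Set.Icc 0 1 = A.carrier
  src_eq : γ 0 = A.src
  tgt_eq : γ 1 = A.tgt

/-- The image of an oriented arc under a map of the sphere. -/
def OrientedArc.image (φ : Sphere2 → Sphere2) (A : OrientedArc) : OrientedArc :=
  ⟨φ '' A.carrier, φ A.src, φ A.tgt⟩

/-- A self-diffeomorphism of the sphere preserves the orientation if it carries positive frames
(represented by velocity vectors of curves) to positive frames. -/
def OrientationPreserving (φ : Sphere2 ≃ₘ⟮𝓡 2, 𝓡 2⟯ Sphere2) : Prop :=
  ∀ f g : ℝ → Sphere2, SmoothCurve f → SmoothCurve g → f 0 = g 0 →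
    0 < det3 (f 0) (velocity f 0) (velocity g 0) →
    0 < det3 (φ (f 0)) (velocity (fun t => φ (f t)) 0) (velocity (fun t => φ (g t)) 0)

/-- The reflection `(x₁, x₂, x₃) ↦ (x₁, -x₂, x₃)` of the sphere. In stereographic coordinates
`ℝ² ∪ {∞}` (projection from a pole on the third axis) it is the reflection along `ℝ × {0}`. -/
noncomputable def reflection2 (p : Sphere2) : Sphere2 :=
  ⟨!₂[(p : EuclideanSpace ℝ (Fin 3)) 0, -(p : EuclideanSpace ℝ (Fin 3)) 1,
      (p : EuclideanSpace ℝ (Fin 3)) 2], by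
    have h := p.2
    rw [mem_sphere_zero_iff_norm, EuclideanSpace.norm_eq] at h ⊢
    simpa [Fin.sum_univ_three] using h⟩

/-! ### Resolution configurations -/

/-- A `k`-dimensional (oriented) resolution configuration: finitely many disjoint smooth circles in
the sphere together with `k` disjoint smoothly embedded oriented arcs, whose endpoints lie on the
circles (which they meet transversally there) and whose interiors are disjoint from the circles. -/
structure ResConfig (k : ℕ) where
  /-- the starting circles -/
  circles : Finset (Set Sphere2)
  arcs : Finset OrientedArc
  card_arcs : arcs.card = k
  circle_smooth : ∀ c ∈ circles, ∃ f, IsCircleParam c f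
  circles_disjoint : ∀ c ∈ circles, ∀ d ∈ circles, c ≠ d → Disjoint c d
  arc_smooth : ∀ A ∈ arcs, ∃ γ, IsArcParam A γ
  arcs_disjoint : ∀ A ∈ arcs, ∀ B ∈ arcs, A ≠ B → Disjoint A.carrier B.carrier
  src_mem : ∀ A ∈ arcs, ∃ c ∈ circles, A.src ∈ c
  tgt_mem : ∀ A ∈ arcs, ∃ c ∈ circles, A.tgt ∈ c
  interior_disjoint : ∀ A ∈ arcs, ∀ c ∈ circles, A.carrier ∩ c ⊆ {A.src, A.tgt}
  transverse : ∀ A ∈ arcs, ∀ γ, IsArcParam A γ → ∀ c ∈ circles, ∀ f, IsCircleParam c f → ∀ t,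
    (f t = A.src → det3 A.src (velocity γ 0) (velocity f t) ≠ 0) ∧
    (f t = A.tgt → det3 A.tgt (velocity γ 1) (velocity f t) ≠ 0)

namespace ResConfig

variable {k : ℕ}

/-- The union of the starting circles. -/
def support (C : ResConfig k) : Set Sphere2 := {P | ∃ c ∈ C.circles, P ∈ c}

/-- The set of all endpoints of arcs. -/
def feet (C : ResConfig k) : Set Sphere2 := {P | ∃ A ∈ C.arcs, P = A.src ∨ P = A.tgt}

/-- `P` and `Q` can be joined along a starting circle without meeting an endpoint of an arc. -/
def SameEdge (C : ResConfig k) (P Q : Sphere2) : Prop :=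
  ∃ c ∈ C.circles, ∃ f, IsCircleParam c f ∧ ∃ r : ℝ, 0 ≤ r ∧
    f 0 = P ∧ f r = Q ∧ ∀ t ∈ Set.Icc 0 r, f t ∉ C.feet

/-- The parametrized starting circle `f` leaves the point `p` and arrives at `P` without meeting an
endpoint of an arc on the way (`p` itself may be such an endpoint). -/
def Leads (C : ResConfig k) (f : ℝ → Sphere2) (p P : Sphere2) : Prop :=
  (∃ c ∈ C.circles, IsCircleParam c f) ∧ ∃ r : ℝ, 0 < r ∧
    f 0 = p ∧ f r = P ∧ ∀ t ∈ Set.Ioc 0 r, f t ∉ C.feet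

/-- Surgery along an arc joins the piece of circle that leaves the initial point of the arc to the
left (right) to the piece of circle that leaves its final point to the left (right), where left and
right are seen when one travels along the arc. -/
def SurgeryJoin (C : ResConfig k) (P Q : Sphere2) : Prop :=
  ∃ A ∈ C.arcs, ∃ γ, IsArcParam A γ ∧ ∃ f g, C.Leads f A.src P ∧ C.Leads g A.tgt Q ∧
    SignType.sign (det3 A.src (velocity γ 0) (velocity f 0)) =
      SignType.sign (det3 A.tgt (velocity γ 1) (velocity g 0))

/-- `P` and `Q` lie on the same ending circle, that is, on the same circle of the one-manifold
obtained from the starting circles by surgery along all the arcs. -/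
def SameEnd (C : ResConfig k) : Sphere2 → Sphere2 → Prop :=
  Relation.EqvGen (fun P Q => C.SameEdge P Q ∨ C.SurgeryJoin P Q)

/-- The ending circles. An ending circle is recorded as the set of those points of the
starting circles, endpoints of arcs excluded, that lie on it after the surgery (which is performed
in arbitrarily thin bands around the arcs). -/
def ends (C : ResConfig k) : Set (Set Sphere2) :=
  {y | ∃ P ∈ C.support, P ∉ C.feet ∧ y = {Q | C.SameEnd P Q}}

open scoped Classical in
/-- The passive circles: the starting circles that are disjoint from all arcs. -/
noncomputable def passive (C : ResConfig k) : Finset (Set Sphere2) :=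
  C.circles.filter (fun c => ∀ A ∈ C.arcs, Disjoint A.carrier c)

theorem src_mem_carrier (C : ResConfig k) {A : OrientedArc} (hA : A ∈ C.arcs) :
    A.src ∈ A.carrier := by
  obtain ⟨γ, h⟩ := C.arc_smooth A hA
  rw [← h.image_eq, ← h.src_eq]
  exact ⟨0, by simp, rfl⟩

theorem tgt_mem_carrier (C : ResConfig k) {A : OrientedArc} (hA : A ∈ C.arcs) :
    A.tgt ∈ A.carrier := by
  obtain ⟨γ, h⟩ := C.arc_smooth A hA
  rw [← h.image_eq, ← h.tgt_eq]
  exact ⟨1, by simp, rfl⟩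

open scoped Classical in
/-- The active part: remove all the passive circles. -/
noncomputable def active (C : ResConfig k) : ResConfig k where
  circles := C.circles.filter (fun c => c ∉ C.passive)
  arcs := C.arcs
  card_arcs := C.card_arcs
  circle_smooth c hc := C.circle_smooth c (Finset.mem_filter.1 hc).1
  circles_disjoint c hc d hd :=
    C.circles_disjoint c (Finset.mem_filter.1 hc).1 d (Finset.mem_filter.1 hd).1
  arc_smooth := C.arc_smooth
  arcs_disjoint := C.arcs_disjoint
  src_mem A hA := by
    obtain ⟨c, hc, h⟩ := C.src_mem A hA
    refine ⟨c, Finset.mem_filter.2 ⟨hc, fun hp => ?_⟩, h⟩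
    exact Set.disjoint_left.1 ((Finset.mem_filter.1 hp).2 A hA) (C.src_mem_carrier hA) h
  tgt_mem A hA := by
    obtain ⟨c, hc, h⟩ := C.tgt_mem A hA
    refine ⟨c, Finset.mem_filter.2 ⟨hc, fun hp => ?_⟩, h⟩
    exact Set.disjoint_left.1 ((Finset.mem_filter.1 hp).2 A hA) (C.tgt_mem_carrier hA) h
  interior_disjoint A hA c hc := C.interior_disjoint A hA c (Finset.mem_filter.1 hc).1
  transverse A hA γ hγ c hc := C.transverse A hA γ hγ c (Finset.mem_filter.1 hc).1

open scoped Classical in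
/-- The sub-configuration formed by the starting circles in `K` and the arcs with both
endpoints on such circles. -/
noncomputable def restrict (C : ResConfig k) (K : Finset (Set Sphere2)) :
    ResConfig (C.arcs.filter (fun A => (∃ c ∈ C.circles, c ∈ K ∧ A.src ∈ c) ∧
      ∃ c ∈ C.circles, c ∈ K ∧ A.tgt ∈ c)).card where
  circles := C.circles.filter (fun c => c ∈ K)
  arcs := C.arcs.filter (fun A => (∃ c ∈ C.circles, c ∈ K ∧ A.src ∈ c) ∧
      ∃ c ∈ C.circles, c ∈ K ∧ A.tgt ∈ c)
  card_arcs := rfl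
  circle_smooth c hc := C.circle_smooth c (Finset.mem_filter.1 hc).1
  circles_disjoint c hc d hd :=
    C.circles_disjoint c (Finset.mem_filter.1 hc).1 d (Finset.mem_filter.1 hd).1
  arc_smooth A hA := C.arc_smooth A (Finset.mem_filter.1 hA).1
  arcs_disjoint A hA B hB :=
    C.arcs_disjoint A (Finset.mem_filter.1 hA).1 B (Finset.mem_filter.1 hB).1
  src_mem A hA := by
    obtain ⟨c, hc, hK, h⟩ := (Finset.mem_filter.1 hA).2.1
    exact ⟨c, Finset.mem_filter.2 ⟨hc, hK⟩, h⟩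
  tgt_mem A hA := by
    obtain ⟨c, hc, hK, h⟩ := (Finset.mem_filter.1 hA).2.2
    exact ⟨c, Finset.mem_filter.2 ⟨hc, hK⟩, h⟩
  interior_disjoint A hA c hc :=
    C.interior_disjoint A (Finset.mem_filter.1 hA).1 c (Finset.mem_filter.1 hc).1
  transverse A hA γ hγ c hc :=
    C.transverse A (Finset.mem_filter.1 hA).1 γ hγ c (Finset.mem_filter.1 hc).1

/-- Two starting circles are linked if they can be joined by a chain of arcs. -/
def Linked (C : ResConfig k) : Set Sphere2 → Set Sphere2 → Prop :=
  Relation.EqvGen (fun c d => c ∈ C.circles ∧ d ∈ C.circles ∧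
    ∃ A ∈ C.arcs, A.src ∈ c ∧ A.tgt ∈ d)

/-- A configuration is connected if it is non-empty and its circles are linked to each other. -/
def Connected (C : ResConfig k) : Prop :=
  C.circles.Nonempty ∧ ∀ c ∈ C.circles, ∀ d ∈ C.circles, C.Linked c d

open scoped Classical in
/-- The connected components, each one given by its set of starting circles. -/
noncomputable def components (C : ResConfig k) : Finset (Finset (Set Sphere2)) :=
  C.circles.image (fun c => C.circles.filter (fun d => C.Linked c d))

/-- A tree: a connected `k`-dimensional configuration with exactly `k + 1` starting circles and
exactly one ending circle. -/
def IsTree (C : ResConfig k) : Prop :=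
  C.Connected ∧ C.circles.card = k + 1 ∧ C.ends.ncard = 1

/-- A dual tree, that is, a configuration dual to a tree: passing to the dual exchanges the starting
with the ending circles and keeps the number of arcs and the connectedness. -/
def IsDualTree (C : ResConfig k) : Prop :=
  C.Connected ∧ C.circles.card = 1 ∧ C.ends.ncard = k + 1

/-- A disjoint union of trees and dual trees. -/
def IsUnionOfTreesAndDualTrees (C : ResConfig k) : Prop :=
  ∀ K ∈ C.components, (C.restrict K).IsTree ∨ (C.restrict K).IsDualTree

/-- The map `φ` of the sphere sends the (oriented) configuration `C` to `D`. -/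
def SendsTo (φ : Sphere2 → Sphere2) (C D : ResConfig k) : Prop :=
  (D.circles : Set (Set Sphere2)) = (fun c => φ '' c) '' (C.circles : Set (Set Sphere2)) ∧
  (D.arcs : Set OrientedArc) = OrientedArc.image φ '' (C.arcs : Set OrientedArc)

/-- `C` and `D` have the same circles and the same arcs, up to the orientation of the arcs. -/
def SameUpToOrientation (C D : ResConfig k) : Prop :=
  C.circles = D.circles ∧ OrientedArc.carrier '' (C.arcs : Set OrientedArc) =
    OrientedArc.carrier '' (D.arcs : Set OrientedArc)

end ResConfig

/-! ### Dual configurations -/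

/-- A profile: the curves `|u| = g v` and `|v| = g u` in the plane are the two smoothings of the
crossing `|u| = |v|`, and are exchanged by the rotation through 90 degrees. -/
structure IsProfile (g : ℝ → ℝ) : Prop where
  smooth : ContDiff ℝ ∞ g
  even : ∀ v, g (-v) = g v
  pos : ∀ v, 0 < g v
  le_one : ∀ v, |v| ≤ 1 → g v ≤ 1
  eq_abs : ∀ v, 1 ≤ |v| → g v = |v|

/-- The closed disc of radius `2` in the plane, in which the surgery takes place. -/
def modelDisc : Set (ℝ × ℝ) := {z | z.1 ^ 2 + z.2 ^ 2 ≤ 4}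

/-- `Ψ` is an orientation preserving smooth embedding of the plane into the sphere. -/
structure IsPlaneChart (Ψ : ℝ × ℝ → Sphere2) : Prop where
  smooth : ContDiff ℝ ∞ (fun z => (Ψ z : EuclideanSpace ℝ (Fin 3)))
  injective : Function.Injective Ψ
  positive : ∀ u v, 0 < det3 (Ψ (u, v)) (velocity (fun t => Ψ (t, v)) u)
    (velocity (fun t => Ψ (u, t)) v)

namespace ResConfig

variable {k : ℕ}

/-- The union of the discs in which the surgeries take place. -/
def surgeryRegion (C : ResConfig k) (Ψ : OrientedArc → ℝ × ℝ → Sphere2) : Set Sphere2 :=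
  {P | ∃ A ∈ C.arcs, P ∈ Ψ A '' modelDisc}

/-- `D` is the dual configuration of `C`, constructed in the disjoint discs given by the charts
`Ψ A` around the arcs `A` of `C`. In the chart, the circles of `C` are the smoothing `|u| = g v` and
`A` is the segment from `(-g 0, 0)` to `(g 0, 0)`; the circles of `D` are the other smoothing
`|v| = g u`, and the dual arc is the segment rotated by 90 degrees counterclockwise. Outside of
the discs the circles are the same. -/
structure IsDualVia (C D : ResConfig k) (Ψ : OrientedArc → ℝ × ℝ → Sphere2)
    (g : OrientedArc → ℝ → ℝ) : Prop where
  profile : ∀ A ∈ C.arcs, IsProfile (g A)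
  chart : ∀ A ∈ C.arcs, IsPlaneChart (Ψ A)
  discs_disjoint : ∀ A ∈ C.arcs, ∀ B ∈ C.arcs, A ≠ B →
    Disjoint (Ψ A '' modelDisc) (Ψ B '' modelDisc)
  circles_chart : ∀ A ∈ C.arcs, ∀ z ∈ modelDisc, Ψ A z ∈ C.support ↔ |z.1| = g A z.2
  arc_chart : ∀ A ∈ C.arcs, A = ⟨Ψ A '' {z | |z.1| ≤ g A 0 ∧ z.2 = 0},
    Ψ A (-g A 0, 0), Ψ A (g A 0, 0)⟩
  dual_circles_chart : ∀ A ∈ C.arcs, ∀ z ∈ modelDisc, Ψ A z ∈ D.support ↔ |z.2| = g A z.1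
  dual_circles_outside : D.support \ C.surgeryRegion Ψ = C.support \ C.surgeryRegion Ψ
  dual_arcs : (D.arcs : Set OrientedArc) = (fun A => ⟨Ψ A '' {z | z.1 = 0 ∧ |z.2| ≤ g A 0},
    Ψ A (0, -g A 0), Ψ A (0, g A 0)⟩) '' (C.arcs : Set OrientedArc)

end ResConfig

/-! ### The vector spaces and the associated maps -/

/-- The monomials in `⨂ 𝔽₂[x]/(x²)`, where `x` runs over a set `X` of circles. The monomial
is given by the finite set of those circles that divide it; the empty set is the monomial `1`. -/
abbrev Monomials (X : Set (Set Sphere2)) : Type :=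
  {a : Finset (Set Sphere2) // ∀ c ∈ a, c ∈ X}

/-- The vector space `⨂ 𝔽₂[x]/(x²)`, `x` running over the (finite) set `X` of circles:
the `𝔽₂`-vector space with the monomials as basis. -/
abbrev CircleSpace (X : Set (Set Sphere2)) : Type := Monomials X →₀ ZMod 2

/-- A family of maps `F_C : V₀(C) → V₁(C)`, one for each `k`-dimensional resolution configuration. -/
abbrev AssociatedMaps (k : ℕ) : Type :=
  ∀ C : ResConfig k, CircleSpace (C.circles : Set (Set Sphere2)) →ₗ[ZMod 2] CircleSpace C.ends

namespace AssociatedMaps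

variable {k : ℕ}

/-- The coefficient of `F_C(a)` at `b`, for monomials `a` and `b`. -/
noncomputable def coeff (F : AssociatedMaps k) (C : ResConfig k)
    (a : Monomials (C.circles : Set (Set Sphere2))) (b : Monomials C.ends) : ZMod 2 :=
  F C (Finsupp.single a 1) b

/-- The bidegree `(gr_h, gr_q)` of a monomial of `V₀(C)`: a factor `1` has `gr_q = 1`, a factor `x`
has `gr_q = -1`, and `gr_h` is normalized to be `0`. -/
noncomputable def startDegree (C : ResConfig k)
    (a : Monomials (C.circles : Set (Set Sphere2))) : ℤ × ℤ :=
  (0, ((C.circles.card : ℤ) - a.1.card) - a.1.card)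

/-- The bidegree `(gr_h, gr_q)` of a monomial of `V₁(C)`; relative to `V₀(C)`, the homological
degree is `k` and the normalized quantum degree is shifted by `k`. -/
noncomputable def endDegree (C : ResConfig k) (b : Monomials C.ends) : ℤ × ℤ :=
  (k, ((C.ends.ncard : ℤ) - b.1.card) - b.1.card + k)

/-- All the maps are homogeneous of the bidegree `d`. -/
def HasBidegree (F : AssociatedMaps k) (d : ℤ × ℤ) : Prop :=
  ∀ C a b, F.coeff C a b ≠ 0 → endDegree C b - startDegree C a = d

/-- Naturality rule: an orientation preserving diffeomorphism that sends `C` to `C'`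
identifies `F_C` with `F_{C'}`. -/
def NaturalityRule (F : AssociatedMaps k) : Prop :=
  ∀ (φ : Sphere2 ≃ₘ⟮𝓡 2, 𝓡 2⟯ Sphere2), OrientationPreserving φ →
    ∀ C C' : ResConfig k, ResConfig.SendsTo φ C C' → ∀ a a' b b',
      (a'.1 : Set (Set Sphere2)) = (fun c => φ '' c) '' (a.1 : Set (Set Sphere2)) →
      (b'.1 : Set (Set Sphere2)) = (fun y => φ '' y) '' (b.1 : Set (Set Sphere2)) →
      F.coeff C' a' b' = F.coeff C a b

/-- Disoriented rule: `F_C` does not depend on the orientation of the arcs. -/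
def DisorientedRule (F : AssociatedMaps k) : Prop :=
  ∀ C C' : ResConfig k, C.SameUpToOrientation C' → ∀ a a' b b', a.1 = a'.1 → b.1 = b'.1 →
    F.coeff C a b = F.coeff C' a' b'

/-- Duality rule: let `D` be the dual of `C` and `E` the mirror image of `D`. The starting circles
`d` of `E` are identified with the ending circles `y` of `C`, and the ending circles `z` of `E` with
the starting circles `c` of `C`, by comparing them outside of the surgery region. If, under these
identifications, `a'` and `b'` are the dual monomials of `a` and `b` (`1* = x`, `x* = 1` in every
tensor factor), then the coefficient of `F_C(a)` at `b` is that of `F_E(b')` at `a'`. -/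
def DualityRule (F : AssociatedMaps k) : Prop :=
  ∀ (C D E : ResConfig k) (Ψ : OrientedArc → ℝ × ℝ → Sphere2) (g : OrientedArc → ℝ → ℝ),
    C.IsDualVia D Ψ g → ResConfig.SendsTo reflection2 D E →
    ∀ (a : Monomials (C.circles : Set (Set Sphere2))) (b : Monomials C.ends)
      (b' : Monomials (E.circles : Set (Set Sphere2))) (a' : Monomials E.ends),
      (∀ c ∈ C.circles, ∀ z ∈ E.ends,
        reflection2 '' (c \ C.surgeryRegion Ψ) = z \ reflection2 '' C.surgeryRegion Ψ →
          (z ∈ a'.1 ↔ c ∉ a.1)) →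
      (∀ y ∈ C.ends, ∀ d ∈ E.circles,
        reflection2 '' (y \ C.surgeryRegion Ψ) = d \ reflection2 '' C.surgeryRegion Ψ →
          (d ∈ b'.1 ↔ y ∉ b.1)) →
      F.coeff C a b = F.coeff E b' a'

open scoped Classical in
/-- Extension rule: `F_C(a · v) = F_{C₀}(a) · v`, where `C₀` is the active part of `C`, `a` is a
monomial of `V₀(C₀)` and `v` is a product of passive circles. It is written out by coefficients: a
monomial of `V₁(C) = V₁(C₀) ⊗ P(C)` has the form `b · w` with `b` in `V₁(C₀)` and `w` in `P(C)`. -/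
def ExtensionRule (F : AssociatedMaps k) : Prop :=
  ∀ (C : ResConfig k) (a : Monomials (C.active.circles : Set (Set Sphere2)))
    (b : Monomials C.active.ends) (v w : Monomials (C.passive : Set (Set Sphere2)))
    (av : Monomials (C.circles : Set (Set Sphere2))) (bw : Monomials C.ends),
    av.1 = a.1 ∪ v.1 → bw.1 = b.1 ∪ w.1 →
    F.coeff C av bw = if w = v then F.coeff C.active a b else 0

/-- Filtration rule: if `x(P)` divides `a` and the coefficient of `F_C(a)` at `b` is non-zero, then
`y(P)` divides `b`, for every point `P`, where `x(P)` and `y(P)` are the starting and the ending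
circle that contain `P`. -/
def FiltrationRule (F : AssociatedMaps k) : Prop :=
  ∀ C a b, F.coeff C a b ≠ 0 → ∀ P : Sphere2, ∀ x ∈ C.circles, ∀ y ∈ C.ends,
    P ∈ x → P ∈ y → x ∈ a.1 → y ∈ b.1

end AssociatedMaps

/-! ### The Sarkar-Seed-Szabo formula -/

namespace ResConfig

variable {k : ℕ}

open scoped Classical in
/-- The coefficients of the tree map (the product of all starting circles is sent to the ending
circle, all other monomials to `0`) and of the dual tree map (`1` is sent to `1 ⊗ … ⊗ 1`, all
other monomials to `0`) of a connected configuration `T`, and `0` if `T` is neither a tree nor a dual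
tree. Here `a` and `b` stand for the monomials formed by the circles of `T` that they contain. -/
noncomputable def treeCoeff (T : ResConfig k) (a b : Finset (Set Sphere2)) : ZMod 2 :=
  if (T.IsTree ∧ (∀ x ∈ T.circles, x ∈ a) ∧ ∀ y ∈ T.ends, y ∈ b) ∨
      (T.IsDualTree ∧ (∀ x ∈ T.circles, x ∉ a) ∧ ∀ y ∈ T.ends, y ∉ b)
  then 1 else 0

open scoped Classical in
/-- The coefficient at `b` of the image of `a` under the map of the Sarkar-Seed-Szabo formula: the
tensor product of the tree maps and dual tree maps of the components of the active part and
of the identity map of the factors that belong to the passive circles. -/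
noncomputable def sssCoeff (C : ResConfig k)
    (a : Monomials (C.circles : Set (Set Sphere2))) (b : Monomials C.ends) : ZMod 2 :=
  (∏ K ∈ C.active.components, (C.active.restrict K).treeCoeff a.1 b.1) *
    ∏ w ∈ C.passive, if (w ∈ a.1 ↔ w ∈ b.1) then 1 else 0

end ResConfig

/-! ### Incidence structures of circles and arcs -/

/-! Let `X` and `Y` be the sets of starting and ending circles, and let the coefficient of `F_C(a)`
at `b` be non-zero. The bidegree gives `(|Y| - 2|b|) - (|X| - 2|a|) = k`, and the filtration rule
says that `b` contains every ending circle that meets a circle of `a`. These two facts determine the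
pair `(a, b)`.

View the arcs as edges of a graph on `X`, and also of a graph on `Y`, where an arc joins the ending
circles along its two sides. The components of the two graphs correspond. Since every component
meeting `a` contains an element of `b`, linear algebra gives `|a| ≤ E(a) + |b|`, with `E(a)` the
number of arcs touching `a`. The complements satisfy the dual condition, so `|Y \ b| ≤ E'(Y \ b) +
|X \ a|`, where `E'` counts arcs in the graph on `Y`. An arc touching `a` has both sides in `b`,
hence `E(a) + E'(Y \ b) ≤ k`. Adding up, the degree is at most `k`, and since it equals `k` all
these inequalities are equalities. In the equality case each component is a tree inside `a` and `b`,
or a dual tree disjoint from both (`IsIncidence.tree_or_dual_tree`).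

The geometric input is `ResConfig.isIncidence`: circles that meet a common ending circle are linked
by arcs, and conversely. A component of the active part has an arc, so it cannot be both a tree and
a dual tree. Thus at most one pair `(a, b)` of the active part has a non-zero coefficient, and over
`𝔽₂` that coefficient is `1`. The extension rule accounts for the passive circles. -/

section Combinatorics

variable {α β γ : Type*}

/-- Two vertices of the multigraph with edges `A` (`e` joins `s e` to `t e`) are joined by a path. -/
def EdgeLinked (A : Finset β) (s t : β → α) : α → α → Prop :=
  Relation.EqvGen (fun x x' => ∃ e ∈ A, s e = x ∧ t e = x')

open scoped Classical in
/-- A set `a` of vertices has at most as many elements as there are edges that touch `a`, plus the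
number of elements of a set `R` that meets all the components contained in `a`. -/
theorem card_le_card_edges_add_card (A : Finset β) (s t : β → α) (a R : Finset α)
    (h : ∀ x ∈ a, ∃ x', EdgeLinked A s t x x' ∧ (x' ∈ R ∨ x' ∉ a)) :
    a.card ≤ (A.filter (fun e => s e ∈ a ∨ t e ∈ a)).card + R.card := by
  set B := A.filter (fun e => s e ∈ a ∨ t e ∈ a) with hB
  -- Functions on `a`, extended by zero, are determined by their differences along the edges
  -- touching `a` and their values on `R`: if these vanish, the extension is constant on each
  -- component and zero somewhere on it. Comparing dimensions gives the bound.
  let ext : (a → ℚ) →ₗ[ℚ] (α → ℚ) :=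
    { toFun := fun f x => if hx : x ∈ a then f ⟨x, hx⟩ else 0
      map_add' := fun f g => by ext x; by_cases hx : x ∈ a <;> simp [hx]
      map_smul' := fun c f => by ext x; by_cases hx : x ∈ a <;> simp [hx] }
  have ext_out : ∀ f x, x ∉ a → ext f x = 0 := fun f x hx => dif_neg hx
  have ext_in : ∀ f (x : a), ext f x = f x := fun f x => dif_pos x.2
  let Φ : (a → ℚ) →ₗ[ℚ] (B → ℚ) × (R → ℚ) :=
    LinearMap.prod
      (LinearMap.pi fun e => LinearMap.proj (s e) ∘ₗ ext - LinearMap.proj (t e) ∘ₗ ext)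
      (LinearMap.pi fun x => LinearMap.proj (x : α) ∘ₗ ext)
  have hinj : Function.Injective Φ := by
    rw [← LinearMap.ker_eq_bot, LinearMap.ker_eq_bot']
    intro f hf
    have h1 : ∀ e ∈ A, ext f (s e) = ext f (t e) := by
      intro e he
      by_cases hB' : s e ∈ a ∨ t e ∈ a
      · have := congrFun (congrArg Prod.fst hf) ⟨e, Finset.mem_filter.2 ⟨he, hB'⟩⟩
        exact sub_eq_zero.1 this
      · push Not at hB'
        rw [ext_out f _ hB'.1, ext_out f _ hB'.2]
    have h2 : ∀ x x', EdgeLinked A s t x x' → ext f x = ext f x' := by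
      intro x x' hx
      induction hx with
      | rel x y h => obtain ⟨e, he, rfl, rfl⟩ := h; exact h1 e he
      | refl => rfl
      | symm _ _ _ ih => exact ih.symm
      | trans _ _ _ _ _ ih1 ih2 => exact ih1.trans ih2
    funext x
    obtain ⟨x', hx', h3⟩ := h x x.2
    rw [← ext_in f x, h2 _ _ hx']
    rcases h3 with h3 | h3
    · exact congrFun (congrArg Prod.snd hf) ⟨x', h3⟩
    · exact ext_out f x' h3
  have := LinearMap.finrank_le_finrank_of_injective hinj
  simpa using this

/-- The combinatorial data of a configuration: vertices `X` (starting circles), `Y` (ending circles)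
and edges `A` (arcs). The edge `e` joins `s e` to `t e` in `X` and `l e` to `r e` in `Y`. -/
structure IsIncidence (X : Finset α) (Y : Finset γ) (A : Finset β) (s t : β → α) (l r : β → γ)
    (I : α → γ → Prop) : Prop where
  s_mem : ∀ e ∈ A, s e ∈ X
  t_mem : ∀ e ∈ A, t e ∈ X
  l_mem : ∀ e ∈ A, l e ∈ Y
  r_mem : ∀ e ∈ A, r e ∈ Y
  s_l : ∀ e ∈ A, I (s e) (l e)
  s_r : ∀ e ∈ A, I (s e) (r e)
  t_l : ∀ e ∈ A, I (t e) (l e)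
  t_r : ∀ e ∈ A, I (t e) (r e)
  exists_right : ∀ x ∈ X, ∃ y ∈ Y, I x y
  exists_left : ∀ y ∈ Y, ∃ x ∈ X, I x y
  linked_left : ∀ x ∈ X, ∀ x' ∈ X, ∀ y ∈ Y, I x y → I x' y → EdgeLinked A s t x x'
  linked_right : ∀ x ∈ X, ∀ y ∈ Y, ∀ y' ∈ Y, I x y → I x y' → EdgeLinked A l r y y'

/-! ### Counting inequalities and their equality case -/

namespace IsIncidence

variable {X : Finset α} {Y : Finset γ} {A : Finset β} {s t : β → α} {l r : β → γ}
  {I : α → γ → Prop}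

/-- The axioms are symmetric, with `s_r` and `t_l` trading places, so that every bound for trees
also serves for dual trees without constructing a dual configuration. -/
theorem dual (h : IsIncidence X Y A s t l r I) :
    IsIncidence Y X A l r s t (fun y x => I x y) where
  s_mem := h.l_mem
  t_mem := h.r_mem
  l_mem := h.s_mem
  r_mem := h.t_mem
  s_l := h.s_l
  s_r := h.t_l
  t_l := h.s_r
  t_r := h.t_r
  exists_right := h.exists_left
  exists_left := h.exists_right
  linked_left y hy y' hy' x hx := h.linked_right x hx y hy y' hy'
  linked_right y hy x hx x' hx' := h.linked_left x hx x' hx' y hy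

theorem mem_of_linked (h : IsIncidence X Y A s t l r I) {x x' : α}
    (hl : EdgeLinked A s t x x') : x ∈ X ↔ x' ∈ X := by
  induction hl with
  | rel x y h' =>
    obtain ⟨e, he, rfl, rfl⟩ := h'
    exact iff_of_true (h.s_mem e he) (h.t_mem e he)
  | refl => rfl
  | symm _ _ _ ih => exact ih.symm
  | trans _ _ _ _ _ ih1 ih2 => exact ih1.trans ih2

/-- Neighbours of linked vertices are linked. -/
theorem linked_of_linked (h : IsIncidence X Y A s t l r I) {x x' : α}
    (hl : EdgeLinked A s t x x') (hx : x ∈ X) {y y' : γ} (hy : y ∈ Y) (hy' : y' ∈ Y)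
    (hxy : I x y) (hxy' : I x' y') : EdgeLinked A l r y y' := by
  induction hl generalizing y y' with
  | rel x x' h' =>
    obtain ⟨e, he, rfl, rfl⟩ := h'
    exact (h.linked_right _ hx _ hy _ (h.l_mem e he) hxy (h.s_l e he)).trans _ _ _
      (h.linked_right _ (h.t_mem e he) _ (h.l_mem e he) _ hy' (h.t_l e he) hxy')
  | refl => exact h.linked_right _ hx _ hy _ hy' hxy hxy'
  | symm _ _ hr ih => exact (ih ((h.mem_of_linked hr).2 hx) hy' hy hxy' hxy).symm
  | trans _ z _ h1 _ ih1 ih2 =>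
    have hz := (h.mem_of_linked h1).1 hx
    obtain ⟨w, hw, hzw⟩ := h.exists_right z hz
    exact (ih1 hx hy hw hxy hzw).trans _ _ _ (ih2 hz hw hy' hzw hxy')

open scoped Classical in
/-- If `b` contains all the neighbours of `a`, then `a` has at most as many elements as there are
edges that touch `a`, plus the number of elements of any subset of `b` that suffices to represent
all the components contained in `a`. -/
theorem card_le_of_subset (h : IsIncidence X Y A s t l r I) {a : Finset α} {b' : Finset γ}
    (hb' : b' ⊆ Y)
    (hab : ∀ x ∈ a, (∃ y ∈ b', ∃ x' ∈ X, I x' y ∧ EdgeLinked A s t x x') ∨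
      ∃ x', EdgeLinked A s t x x' ∧ x' ∉ a) :
    a.card ≤ (A.filter (fun e => s e ∈ a ∨ t e ∈ a)).card + b'.card := by
  -- One neighbour `f y` for each `y ∈ b'` makes up the set `R`. By `linked_left` any other
  -- neighbour of `y` is linked to `f y`, so the choice does not matter.
  choose f hfX hfI using h.exists_left
  refine (card_le_card_edges_add_card A s t a
    (b'.attach.image fun y => f y.1 (hb' y.2)) fun x hx => ?_).trans
    (Nat.add_le_add_left (Finset.card_image_le.trans Finset.card_attach.le) _)
  rcases hab x hx with ⟨y, hy, x', hx', hI, hl⟩ | ⟨x', hl, hx'⟩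
  · exact ⟨f y (hb' hy), hl.trans _ _ _ (h.linked_left _ hx' _ (hfX y (hb' hy)) y (hb' hy) hI
      (hfI y (hb' hy))), Or.inl (Finset.mem_image.2 ⟨⟨y, hy⟩, Finset.mem_attach _ _, rfl⟩)⟩
  · exact ⟨x', hl, Or.inr hx'⟩

open scoped Classical in
theorem card_le (h : IsIncidence X Y A s t l r I) {a : Finset α} {b : Finset γ}
    (ha : a ⊆ X) (hb : b ⊆ Y) (hab : ∀ x ∈ a, ∀ y ∈ Y, I x y → y ∈ b) :
    a.card ≤ (A.filter (fun e => s e ∈ a ∨ t e ∈ a)).card + b.card :=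
  h.card_le_of_subset hb fun x hx => by
    obtain ⟨y, hy, hI⟩ := h.exists_right x (ha hx)
    exact Or.inl ⟨y, hab x hx y hy hI, x, ha hx, hI, .refl _⟩

open scoped Classical in
/-- In the case of equality in `card_le`, all the components that meet `b` are contained in `a`. -/
theorem linked_mem_of_card_eq (h : IsIncidence X Y A s t l r I) {a : Finset α} {b : Finset γ}
    (ha : a ⊆ X) (hb : b ⊆ Y) (hab : ∀ x ∈ a, ∀ y ∈ Y, I x y → y ∈ b)
    (heq : (A.filter (fun e => s e ∈ a ∨ t e ∈ a)).card + b.card ≤ a.card)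
    {y : γ} (hy : y ∈ b) {x x' : α} (hx : x ∈ X) (hI : I x y) (hl : EdgeLinked A s t x x') :
    x' ∈ a := by
  by_contra hx'
  -- The element `x'` outside `a` already takes care of the component of `y`, so `y` could be
  -- dropped and the bound would improve by one.
  have := h.card_le_of_subset (a := a) (b' := b.erase y)
    ((Finset.erase_subset _ _).trans hb) fun z hz => by
      obtain ⟨w, hw, hzw⟩ := h.exists_right z (ha hz)
      by_cases hwy : w = y
      · subst hwy
        exact Or.inr ⟨x', (h.linked_left _ (ha hz) _ hx _ hw hzw hI).trans _ _ _ hl, hx'⟩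
      · exact Or.inl ⟨w, Finset.mem_erase.2 ⟨hwy, hab z hz w hw hzw⟩, z, ha hz, hzw, .refl _⟩
  have := Finset.card_erase_lt_of_mem hy
  omega

open scoped Classical in
/-- In the case of equality in `card_le`, every component contains at most one element of `b`. -/
theorem eq_of_card_eq (h : IsIncidence X Y A s t l r I) {a : Finset α} {b : Finset γ}
    (ha : a ⊆ X) (hb : b ⊆ Y) (hab : ∀ x ∈ a, ∀ y ∈ Y, I x y → y ∈ b)
    (heq : (A.filter (fun e => s e ∈ a ∨ t e ∈ a)).card + b.card ≤ a.card)
    {y y' : γ} (hy : y ∈ b) (hy' : y' ∈ b) {x x' : α} (hx : x ∈ X) (hx' : x' ∈ X) (hI : I x y)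
    (hI' : I x' y') (hl : EdgeLinked A s t x x') : y = y' := by
  by_contra hne
  -- Here `y'` represents the component of `y`, so again `y` is redundant.
  have := h.card_le_of_subset (a := a) (b' := b.erase y)
    ((Finset.erase_subset _ _).trans hb) fun z hz => by
      obtain ⟨w, hw, hzw⟩ := h.exists_right z (ha hz)
      left
      by_cases hwy : w = y
      · subst hwy
        exact ⟨y', Finset.mem_erase.2 ⟨Ne.symm hne, hy'⟩, x', hx', hI',
          (h.linked_left _ (ha hz) _ hx _ hw hzw hI).trans _ _ _ hl⟩
      · exact ⟨w, Finset.mem_erase.2 ⟨hwy, hab z hz w hw hzw⟩, z, ha hz, hzw, .refl _⟩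
  have := Finset.card_erase_lt_of_mem hy
  omega

open scoped Classical in
/-- In the case of equality in `card_le`, every component contained in `a` is a tree. -/
theorem card_component_of_card_eq (h : IsIncidence X Y A s t l r I) {a : Finset α} {b : Finset γ}
    (ha : a ⊆ X) (hb : b ⊆ Y) (hab : ∀ x ∈ a, ∀ y ∈ Y, I x y → y ∈ b)
    (heq : (A.filter (fun e => s e ∈ a ∨ t e ∈ a)).card + b.card ≤ a.card)
    {x : α} (hxX : x ∈ X) (hx : ∀ x', EdgeLinked A s t x x' → x' ∈ a) :
    (X.filter (fun x' => EdgeLinked A s t x x')).card =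
      (A.filter (fun e => EdgeLinked A s t x (s e))).card + 1 := by
  set K := X.filter (fun x' => EdgeLinked A s t x x') with hK
  have hmemK : ∀ {z}, z ∈ K ↔ EdgeLinked A s t x z := fun {z} => by
    rw [hK, Finset.mem_filter]
    exact ⟨fun h => h.2, fun hz => ⟨(h.mem_of_linked hz).1 hxX, hz⟩⟩
  have hst : ∀ e ∈ A, (s e ∈ K ↔ t e ∈ K) := fun e he => by
    have : EdgeLinked A s t (s e) (t e) := .rel _ _ ⟨e, he, rfl, rfl⟩
    rw [hmemK, hmemK]
    exact ⟨fun h => h.trans _ _ _ this, fun h => h.trans _ _ _ this.symm⟩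
  have hKa : K ⊆ a := fun z hz => hx z (hmemK.1 hz)
  have hAK : A.filter (fun e => EdgeLinked A s t x (s e)) =
      A.filter (fun e => s e ∈ K ∨ t e ∈ K) := Finset.filter_congr fun e he => by
    rw [← hst e he, or_self, hmemK]
  -- A connected graph has at most one more vertex than edges; the single representative is `x`.
  have hle : K.card ≤ (A.filter (fun e => s e ∈ K ∨ t e ∈ K)).card + 1 := by
    refine (card_le_card_edges_add_card A s t K {x} fun z hz => ⟨x, (hmemK.1 hz).symm, ?_⟩).trans
      (by simp)
    simp
  obtain ⟨y, hy, hI⟩ := h.exists_right x hxX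
  have hyb : y ∈ b := hab x (hx x (.refl _)) y hy hI
  -- For the opposite bound, the component `K` is removed from `a`, and with it `y` from `b`: a
  -- neighbour of `y` is linked to `x`, hence lies in `K`. Subtracting this from the equality for
  -- `a` leaves at least one more vertex than edges in `K`.
  have hge := h.card_le_of_subset (a := a \ K) (b' := b.erase y)
    ((Finset.erase_subset _ _).trans hb) fun z hz => by
      obtain ⟨hza, hzK⟩ := Finset.mem_sdiff.1 hz
      obtain ⟨w, hw, hzw⟩ := h.exists_right z (ha hza)
      refine Or.inl ⟨w, Finset.mem_erase.2 ⟨?_, hab z hza w hw hzw⟩, z, ha hza, hzw, .refl _⟩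
      rintro rfl
      exact hzK (hmemK.2 (h.linked_left _ hxX _ (ha hza) _ hw hI hzw))
  have hsplit : (A.filter (fun e => s e ∈ a \ K ∨ t e ∈ a \ K)).card +
      (A.filter (fun e => s e ∈ K ∨ t e ∈ K)).card ≤
      (A.filter (fun e => s e ∈ a ∨ t e ∈ a)).card := by
    rw [← Finset.card_union_of_disjoint]
    · refine Finset.card_le_card fun e he => ?_
      simp only [Finset.mem_union, Finset.mem_filter, Finset.mem_sdiff] at he ⊢
      have h1 := @hKa (s e)
      have h2 := @hKa (t e)
      tauto
    · rw [Finset.disjoint_left]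
      intro e he he'
      simp only [Finset.mem_filter, Finset.mem_sdiff] at he he'
      have := hst e he.1
      tauto
  have h1 := Finset.card_sdiff_add_card_eq_card hKa
  have h2 := Finset.card_erase_add_one hyb
  rw [hAK]
  omega

open scoped Classical in
/-- Let `a` and `b` be sets of vertices such that `b` contains the neighbours of `a`. If the degree
`(|Y| - 2 |b|) - (|X| - 2 |a|)` is the number of edges, then every component is a tree contained in
`a` and `b` or a dual tree disjoint from `a` and `b`. -/
theorem tree_or_dual_tree (h : IsIncidence X Y A s t l r I) {a : Finset α} {b : Finset γ}
    (ha : a ⊆ X) (hb : b ⊆ Y) (hab : ∀ x ∈ a, ∀ y ∈ Y, I x y → y ∈ b)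
    (hdeg : ((Y.card : ℤ) - 2 * b.card) - (X.card - 2 * a.card) = A.card) {x : α} (hx : x ∈ X) :
    ((X.filter (fun x' => EdgeLinked A s t x x') ⊆ a ∧
        Y.filter (fun y => ∃ x', EdgeLinked A s t x x' ∧ I x' y) ⊆ b) ∧
      (X.filter (fun x' => EdgeLinked A s t x x')).card =
        (A.filter (fun e => EdgeLinked A s t x (s e))).card + 1 ∧
      (Y.filter (fun y => ∃ x', EdgeLinked A s t x x' ∧ I x' y)).card = 1) ∨
    ((Disjoint (X.filter (fun x' => EdgeLinked A s t x x')) a ∧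
        Disjoint (Y.filter (fun y => ∃ x', EdgeLinked A s t x x' ∧ I x' y)) b) ∧
      (X.filter (fun x' => EdgeLinked A s t x x')).card = 1 ∧
      (Y.filter (fun y => ∃ x', EdgeLinked A s t x x' ∧ I x' y)).card =
        (A.filter (fun e => EdgeLinked A s t x (s e))).card + 1) := by
  have hab' : ∀ y ∈ Y \ b, ∀ x ∈ X, I x y → x ∈ X \ a := fun y hy x hx hI => by
    rw [Finset.mem_sdiff] at hy ⊢
    exact ⟨hx, fun hxa => hy.2 (hab x hxa y hy.1 hI)⟩
  have hle := h.card_le ha hb hab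
  have hle' := h.dual.card_le (a := Y \ b) (b := X \ a) Finset.sdiff_subset Finset.sdiff_subset hab'
  -- An edge that touches `a` has both of its ends in `Y` inside `b`, so no edge is counted twice.
  have hsplit : (A.filter (fun e => s e ∈ a ∨ t e ∈ a)).card +
      (A.filter (fun e => l e ∈ Y \ b ∨ r e ∈ Y \ b)).card ≤ A.card := by
    rw [← Finset.card_union_of_disjoint]
    · exact Finset.card_le_card
        (Finset.union_subset (Finset.filter_subset _ _) (Finset.filter_subset _ _))
    · rw [Finset.disjoint_left]
      intro e he he'
      simp only [Finset.mem_filter, Finset.mem_sdiff] at he he'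
      obtain ⟨heA, he⟩ := he
      rcases he with he | he
      · have h1 := hab _ he _ (h.l_mem e heA) (h.s_l e heA)
        have h2 := hab _ he _ (h.r_mem e heA) (h.s_r e heA)
        tauto
      · have h1 := hab _ he _ (h.l_mem e heA) (h.t_l e heA)
        have h2 := hab _ he _ (h.r_mem e heA) (h.t_r e heA)
        tauto
  have hca := Finset.card_sdiff_add_card_eq_card ha
  have hcb := Finset.card_sdiff_add_card_eq_card hb
  -- The sum of `hle`, `hle'` and `hsplit` bounds the degree by `|A|`; as `hdeg` attains the bound,
  -- none of the three is strict.
  have heq : (A.filter (fun e => s e ∈ a ∨ t e ∈ a)).card + b.card ≤ a.card := by omega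
  have heq' : (A.filter (fun e => l e ∈ Y \ b ∨ r e ∈ Y \ b)).card + (X \ a).card ≤
    (Y \ b).card := by omega
  have hX : ∀ {z}, EdgeLinked A s t x z → z ∈ X := fun hz => (h.mem_of_linked hz).1 hx
  obtain ⟨y, hy, hxy⟩ := h.exists_right x hx
  by_cases hxa : x ∈ a
  · left
    have hK : ∀ z, EdgeLinked A s t x z → z ∈ a := fun z hz =>
      h.linked_mem_of_card_eq ha hb hab heq (hab x hxa y hy hxy) hx hxy hz
    refine ⟨⟨fun z hz => hK z (Finset.mem_filter.1 hz).2, fun w hw => ?_⟩,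
      h.card_component_of_card_eq ha hb hab heq hx hK, ?_⟩
    · obtain ⟨hwY, z, hz, hI⟩ := Finset.mem_filter.1 hw
      exact hab z (hK z hz) w hwY hI
    · rw [Finset.card_eq_one]
      refine ⟨y, Finset.eq_singleton_iff_unique_mem.2
        ⟨Finset.mem_filter.2 ⟨hy, x, .refl _, hxy⟩, fun w hw => ?_⟩⟩
      obtain ⟨hwY, z, hz, hI⟩ := Finset.mem_filter.1 hw
      exact (h.eq_of_card_eq ha hb hab heq (hab x hxa y hy hxy) (hab z (hK z hz) w hwY hI)
        hx (hX hz) hxy hI hz).symm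
  · right
    have hxa' : x ∈ X \ a := Finset.mem_sdiff.2 ⟨hx, hxa⟩
    have hL : ∀ w, EdgeLinked A l r y w → w ∈ Y \ b := fun w hw =>
      h.dual.linked_mem_of_card_eq Finset.sdiff_subset Finset.sdiff_subset hab' heq' hxa' hy hxy hw
    -- The component of `x` is rewritten as the component of `y` in the graph on `Y`, so that the
    -- tree case applies to the dual structure with `Y \ b` and `X \ a`.
    have hYK : Y.filter (fun y => ∃ x', EdgeLinked A s t x x' ∧ I x' y) =
        Y.filter (fun w => EdgeLinked A l r y w) := Finset.filter_congr fun w hw => by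
      refine ⟨fun ⟨z, hz, hI⟩ => h.linked_of_linked hz hx hy hw hxy hI, fun hl => ?_⟩
      obtain ⟨z, hz, hI⟩ := h.exists_left w hw
      exact ⟨z, h.dual.linked_of_linked hl hy hx hz hxy hI, hI⟩
    have hAK : A.filter (fun e => EdgeLinked A s t x (s e)) =
        A.filter (fun e => EdgeLinked A l r y (l e)) := Finset.filter_congr fun e he =>
      ⟨fun hl => h.linked_of_linked hl hx hy (h.l_mem e he) hxy (h.s_l e he),
        fun hl => h.dual.linked_of_linked hl hy hx (h.s_mem e he) hxy (h.s_l e he)⟩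
    have hK : ∀ z, EdgeLinked A s t x z → z ∈ X \ a := fun z hz => by
      obtain ⟨w, hw, hI⟩ := h.exists_right z (hX hz)
      exact hab' w (hL w (h.linked_of_linked hz hx hy hw hxy hI)) z (hX hz) hI
    refine ⟨⟨Finset.disjoint_left.2 fun z hz =>
      (Finset.mem_sdiff.1 (hK z (Finset.mem_filter.1 hz).2)).2, ?_⟩, ?_, ?_⟩
    · rw [hYK]
      exact Finset.disjoint_left.2 fun w hw =>
        (Finset.mem_sdiff.1 (hL w (Finset.mem_filter.1 hw).2)).2
    · rw [Finset.card_eq_one]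
      refine ⟨x, Finset.eq_singleton_iff_unique_mem.2
        ⟨Finset.mem_filter.2 ⟨hx, .refl _⟩, fun z hz => ?_⟩⟩
      replace hz := (Finset.mem_filter.1 hz).2
      obtain ⟨w, hw, hI⟩ := h.exists_right z (hX hz)
      exact (h.dual.eq_of_card_eq Finset.sdiff_subset Finset.sdiff_subset hab' heq' hxa' (hK z hz)
        hy hw hxy hI (h.linked_of_linked hz hx hy hw hxy hI)).symm
    · rw [hYK, hAK]
      exact h.dual.card_component_of_card_eq Finset.sdiff_subset Finset.sdiff_subset hab' heq' hy hL

end IsIncidence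

end Combinatorics

/-! ### Circles, feet and ending circles -/

theorem det3_neg (p u v : EuclideanSpace ℝ (Fin 3)) : det3 p u (-v) = -det3 p u v := by
  simp only [det3, Matrix.det_fin_three]
  simp
  ring

theorem velocity_comp_add_const (f : ℝ → Sphere2) (s t : ℝ) :
    velocity (fun t => f (t + s)) t = velocity f (t + s) :=
  deriv_comp_add_const (f := fun t => (f t : EuclideanSpace ℝ (Fin 3))) s t

theorem velocity_comp_const_sub (f : ℝ → Sphere2) (s t : ℝ) :
    velocity (fun t => f (s - t)) t = -velocity f (s - t) :=
  deriv_comp_const_sub (f := fun t => (f t : EuclideanSpace ℝ (Fin 3))) s t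

namespace IsCircleParam

variable {c : Set Sphere2} {f : ℝ → Sphere2}

theorem mem (h : IsCircleParam c f) (t : ℝ) : f t ∈ c := h.range_eq ▸ Set.mem_range_self t

theorem apply_fract (h : IsCircleParam c f) (t : ℝ) : f (Int.fract t) = f t := by
  have := h.periodic.sub_int_mul_eq (x := t) ⌊t⌋
  rwa [mul_one] at this

theorem exists_int_of_eq (h : IsCircleParam c f) {s t : ℝ} (hst : f s = f t) :
    ∃ z : ℤ, s - t = z :=
  Int.fract_eq_fract.1 (h.injOn ⟨Int.fract_nonneg _, Int.fract_lt_one _⟩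
    ⟨Int.fract_nonneg _, Int.fract_lt_one _⟩ (by rw [h.apply_fract, h.apply_fract, hst]))

theorem eq_of_int {s t : ℝ} (hs : s ∈ Set.Ico (0 : ℝ) 1) (ht : t ∈ Set.Ico (0 : ℝ) 1)
    (h : ∃ z : ℤ, s - t = z) : s = t := by
  obtain ⟨z, hz⟩ := h
  have h1 : (z : ℝ) < 1 := by linarith [hs.2, ht.1]
  have h2 : (-1 : ℝ) < z := by linarith [hs.1, ht.2]
  have h3 : z = 0 := by
    have h1' : z < 1 := by exact_mod_cast h1
    have h2' : -1 < z := by exact_mod_cast h2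
    omega
  rw [h3, Int.cast_zero] at hz
  linarith

theorem shift (h : IsCircleParam c f) (s : ℝ) : IsCircleParam c (fun t => f (t + s)) where
  smooth := h.smooth.comp (contDiff_id.add contDiff_const)
  periodic t := by
    have := h.periodic (t + s)
    rwa [add_right_comm] at this
  injOn a ha b hb hab := by
    obtain ⟨z, hz⟩ := h.exists_int_of_eq hab
    exact eq_of_int ha hb ⟨z, by linarith⟩
  regular t := by
    rw [velocity_comp_add_const]
    exact h.regular _
  range_eq := by
    rw [← h.range_eq]
    exact (Equiv.addRight s).surjective.range_comp f

theorem reverse (h : IsCircleParam c f) (s : ℝ) : IsCircleParam c (fun t => f (s - t)) where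
  smooth := h.smooth.comp (contDiff_const.sub contDiff_id)
  periodic t := by
    have := h.periodic (s - (t + 1))
    rw [show s - (t + 1) + 1 = s - t by ring] at this
    exact this.symm
  injOn a ha b hb hab := by
    obtain ⟨z, hz⟩ := h.exists_int_of_eq hab
    exact eq_of_int ha hb ⟨-z, by push_cast; linarith⟩
  regular t := by
    rw [velocity_comp_const_sub]
    exact neg_ne_zero.2 (h.regular _)
  range_eq := by
    rw [← h.range_eq]
    exact (Equiv.subLeft s).surjective.range_comp f

theorem exists_mem_Ico (h : IsCircleParam c f) {P : Sphere2} (hP : P ∈ c) :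
    ∃ t ∈ Set.Ico (0 : ℝ) 1, f t = P := by
  rw [← h.range_eq] at hP
  obtain ⟨t, rfl⟩ := hP
  exact ⟨Int.fract t, ⟨Int.fract_nonneg _, Int.fract_lt_one _⟩, h.apply_fract t⟩

end IsCircleParam

/-- For `S` the set of times at which a circle passes a foot, this yields a stretch just after `x`
without feet; `z` keeps it inside one period. -/
theorem Set.Finite.exists_gap_above {S : Set ℝ} (hS : S.Finite) {x z : ℝ} (hxz : x < z) :
    ∃ y, x < y ∧ y < z ∧ ∀ t ∈ S, x < t → y < t := by
  induction S, hS using Set.Finite.induction_on with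
  | empty => exact ⟨(x + z) / 2, by linarith, by linarith, by simp⟩
  | @insert a S _ _ ih =>
    obtain ⟨y, h1, h2, h3⟩ := ih
    by_cases ha : x < a
    · have hm := min_le_left y ((x + a) / 2)
      have hm' := min_le_right y ((x + a) / 2)
      refine ⟨min y ((x + a) / 2), lt_min h1 (by linarith), by linarith, ?_⟩
      rintro t (rfl | ht) hxt
      · linarith
      · linarith [h3 t ht hxt]
    · refine ⟨y, h1, h2, ?_⟩
      rintro t (rfl | ht) hxt
      · exact absurd hxt ha
      · exact h3 t ht hxt

theorem Set.Finite.exists_gap_below {S : Set ℝ} (hS : S.Finite) {x z : ℝ} (hzx : z < x) :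
    ∃ y, z < y ∧ y < x ∧ ∀ t ∈ S, t < x → t < y := by
  obtain ⟨y, h1, h2, h3⟩ := (hS.image Neg.neg).exists_gap_above (neg_lt_neg hzx)
  refine ⟨-y, by linarith, by linarith, fun t ht htx => ?_⟩
  linarith [h3 (-t) ⟨t, ht, rfl⟩ (by linarith)]

namespace ResConfig

variable {k : ℕ}

theorem exists_param_at (C : ResConfig k) {c : Set Sphere2} (hc : c ∈ C.circles) {P : Sphere2}
    (hP : P ∈ c) : ∃ f, IsCircleParam c f ∧ f 0 = P := by
  obtain ⟨f, hf⟩ := C.circle_smooth c hc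
  obtain ⟨t, -, rfl⟩ := hf.exists_mem_Ico hP
  exact ⟨_, hf.shift t, by simp⟩

theorem circle_eq_of_mem (C : ResConfig k) {c d : Set Sphere2} (hc : c ∈ C.circles)
    (hd : d ∈ C.circles) {P : Sphere2} (hPc : P ∈ c) (hPd : P ∈ d) : c = d := by
  by_contra h
  exact Set.disjoint_left.1 (C.circles_disjoint c hc d hd h) hPc hPd

theorem feet_finite (C : ResConfig k) : C.feet.Finite := by
  refine ((C.arcs.finite_toSet.image OrientedArc.src).union
    (C.arcs.finite_toSet.image OrientedArc.tgt)).subset ?_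
  rintro P ⟨A, hA, rfl | rfl⟩
  · exact Or.inl ⟨A, hA, rfl⟩
  · exact Or.inr ⟨A, hA, rfl⟩

theorem finite_foot_times (C : ResConfig k) {c : Set Sphere2} {f : ℝ → Sphere2}
    (hf : IsCircleParam c f) : {t | t ∈ Set.Ico (0 : ℝ) 1 ∧ f t ∈ C.feet}.Finite := by
  refine Set.Finite.of_finite_image (f := f) (C.feet_finite.subset ?_)
    (hf.injOn.mono fun t ht => ht.1)
  rintro _ ⟨t, ht, rfl⟩
  exact ht.2

theorem exists_leads (C : ResConfig k) {c : Set Sphere2} (hc : c ∈ C.circles) {f : ℝ → Sphere2}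
    (hf : IsCircleParam c f) : ∃ P, C.Leads f (f 0) P := by
  obtain ⟨r, h1, h2, h3⟩ := (C.finite_foot_times hf).exists_gap_above (zero_lt_one' ℝ)
  exact ⟨f r, ⟨c, hc, hf⟩, r, h1, rfl, rfl, fun t ht hft =>
    (h3 t ⟨⟨ht.1.le, ht.2.trans_lt h2⟩, hft⟩ ht.1).not_ge ht.2⟩

theorem Leads.not_mem_feet {C : ResConfig k} {f : ℝ → Sphere2} {p P : Sphere2}
    (h : C.Leads f p P) : P ∉ C.feet := by
  obtain ⟨-, r, hr, -, rfl, h⟩ := h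
  exact h r ⟨hr, le_rfl⟩

theorem Leads.mem {C : ResConfig k} {f : ℝ → Sphere2} {p P : Sphere2}
    (h : C.Leads f p P) : ∃ c ∈ C.circles, p ∈ c ∧ P ∈ c := by
  obtain ⟨⟨c, hc, hf⟩, r, hr, rfl, rfl, h⟩ := h
  exact ⟨c, hc, hf.mem _, hf.mem _⟩

theorem SameEdge.mem {C : ResConfig k} {P Q : Sphere2} (h : C.SameEdge P Q) :
    ∃ c ∈ C.circles, P ∈ c ∧ Q ∈ c := by
  obtain ⟨c, hc, f, hf, r, -, rfl, rfl, -⟩ := h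
  exact ⟨c, hc, hf.mem _, hf.mem _⟩

theorem SameEdge.not_mem_feet {C : ResConfig k} {P Q : Sphere2} (h : C.SameEdge P Q) :
    P ∉ C.feet ∧ Q ∉ C.feet := by
  obtain ⟨c, hc, f, hf, r, hr, rfl, rfl, h⟩ := h
  exact ⟨h 0 ⟨le_rfl, hr⟩, h r ⟨hr, le_rfl⟩⟩

theorem SameEnd.mem_iff {C : ResConfig k} {P Q : Sphere2} (h : C.SameEnd P Q) :
    (P ∈ C.support ∧ P ∉ C.feet) ↔ (Q ∈ C.support ∧ Q ∉ C.feet) := by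
  induction h with
  | rel P Q h =>
    rcases h with h | ⟨A, -, -, -, f, g, hf, hg, -⟩
    · obtain ⟨c, hc, hP, hQ⟩ := h.mem
      exact iff_of_true ⟨⟨c, hc, hP⟩, h.not_mem_feet.1⟩ ⟨⟨c, hc, hQ⟩, h.not_mem_feet.2⟩
    · obtain ⟨c, hc, -, hP⟩ := hf.mem
      obtain ⟨d, hd, -, hQ⟩ := hg.mem
      exact iff_of_true ⟨⟨c, hc, hP⟩, hf.not_mem_feet⟩ ⟨⟨d, hd, hQ⟩, hg.not_mem_feet⟩
  | refl => rfl
  | symm _ _ _ ih => exact ih.symm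
  | trans _ _ _ _ _ ih1 ih2 => exact ih1.trans ih2

/-- The ending circle that contains the point `P`. -/
def endOf (C : ResConfig k) (P : Sphere2) : Set Sphere2 := {Q | C.SameEnd P Q}

theorem mem_endOf (C : ResConfig k) (P : Sphere2) : P ∈ C.endOf P := .refl _

theorem SameEnd.endOf_eq {C : ResConfig k} {P Q : Sphere2} (h : C.SameEnd P Q) :
    C.endOf P = C.endOf Q :=
  Set.ext fun _ => ⟨fun hR => h.symm.trans _ _ _ hR, fun hR => h.trans _ _ _ hR⟩

theorem endOf_mem_ends (C : ResConfig k) {P : Sphere2} (hP : P ∈ C.support) (hP' : P ∉ C.feet) :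
    C.endOf P ∈ C.ends := ⟨P, hP, hP', rfl⟩

theorem eq_endOf {C : ResConfig k} {y : Set Sphere2} (hy : y ∈ C.ends) {P : Sphere2}
    (hP : P ∈ y) : y = C.endOf P := by
  obtain ⟨Q, -, -, rfl⟩ := hy
  exact SameEnd.endOf_eq hP

theorem mem_support_of_mem_end {C : ResConfig k} {y : Set Sphere2} (hy : y ∈ C.ends) {P : Sphere2}
    (hP : P ∈ y) : P ∈ C.support ∧ P ∉ C.feet := by
  obtain ⟨Q, hQ, hQ', rfl⟩ := hy
  exact (SameEnd.mem_iff hP).1 ⟨hQ, hQ'⟩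

/-- The starting circle that contains the point `P`. -/
noncomputable def circleAt (C : ResConfig k) (P : Sphere2) : Set Sphere2 :=
  Classical.epsilon fun c => c ∈ C.circles ∧ P ∈ c

theorem circleAt_spec {C : ResConfig k} {P : Sphere2} (hP : P ∈ C.support) :
    C.circleAt P ∈ C.circles ∧ P ∈ C.circleAt P :=
  Classical.epsilon_spec (p := fun c => c ∈ C.circles ∧ P ∈ c) hP

theorem circleAt_eq {C : ResConfig k} {c : Set Sphere2} (hc : c ∈ C.circles) {P : Sphere2}
    (hP : P ∈ c) : C.circleAt P = c :=
  have h := circleAt_spec ⟨c, hc, hP⟩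
  C.circle_eq_of_mem h.1 hc h.2 hP

/-! ### The two ending circles along an arc -/

/-- A chosen parametrization of an arc. -/
noncomputable def arcParam (A : OrientedArc) : ℝ → Sphere2 :=
  @Classical.epsilon _ ⟨fun _ => A.src⟩ (IsArcParam A)

theorem isArcParam (C : ResConfig k) {A : OrientedArc} (hA : A ∈ C.arcs) :
    IsArcParam A (arcParam A) := Classical.epsilon_spec (C.arc_smooth A hA)

/-- `P` lies on the piece of circle that leaves the initial point of `A` to the side `σ`. -/
def LeavesSrc (C : ResConfig k) (A : OrientedArc) (σ : SignType) (P : Sphere2) : Prop :=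
  ∃ f, C.Leads f A.src P ∧
    SignType.sign (det3 A.src (velocity (arcParam A) 0) (velocity f 0)) = σ

/-- `P` lies on the piece of circle that leaves the final point of `A` to the side `σ`. -/
def LeavesTgt (C : ResConfig k) (A : OrientedArc) (σ : SignType) (P : Sphere2) : Prop :=
  ∃ f, C.Leads f A.tgt P ∧
    SignType.sign (det3 A.tgt (velocity (arcParam A) 1) (velocity f 0)) = σ

theorem SignType.eq_one_or_eq_neg_one {σ : SignType} (h : σ ≠ 0) : σ = 1 ∨ σ = -1 := by
  revert h; cases σ <;> decide

/-- Reversing a parametrization flips the sign of the determinant, which is non-zero by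
transversality; so the circle leaves `P` to either side. The vector `u P` stands for the velocity of
the arc at either of its feet. -/
theorem exists_velocity_sign {C : ResConfig k} {c : Set Sphere2} (hc : c ∈ C.circles)
    {p u : Sphere2 → EuclideanSpace ℝ (Fin 3)} {P : Sphere2} (hP : P ∈ c)
    (h : ∀ f, IsCircleParam c f → f 0 = P → det3 (p P) (u P) (velocity f 0) ≠ 0)
    {σ : SignType} (hσ : σ ≠ 0) :
    ∃ f Q, C.Leads f P Q ∧ SignType.sign (det3 (p P) (u P) (velocity f 0)) = σ := by
  obtain ⟨f, hf, rfl⟩ := C.exists_param_at hc hP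
  have hne := h f hf rfl
  have hsign := SignType.eq_one_or_eq_neg_one (sign_ne_zero.2 hne)
  by_cases hs : SignType.sign (det3 (p (f 0)) (u (f 0)) (velocity f 0)) = σ
  · obtain ⟨Q, hQ⟩ := C.exists_leads hc hf
    exact ⟨f, Q, hQ, hs⟩
  · obtain ⟨Q, hQ⟩ := C.exists_leads hc (hf.reverse 0)
    rw [sub_zero] at hQ
    refine ⟨_, Q, hQ, ?_⟩
    rw [velocity_comp_const_sub, det3_neg, sub_zero, Left.sign_neg]
    rcases hsign with h1 | h1 <;> rcases SignType.eq_one_or_eq_neg_one hσ with h2 | h2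
    · exact absurd (h1.trans h2.symm) hs
    · rw [h1, h2]
    · rw [h1, h2, neg_neg]
    · exact absurd (h1.trans h2.symm) hs

theorem exists_leavesSrc (C : ResConfig k) {A : OrientedArc} (hA : A ∈ C.arcs) {σ : SignType}
    (hσ : σ ≠ 0) : ∃ P, C.LeavesSrc A σ P := by
  obtain ⟨c, hc, hAc⟩ := C.src_mem A hA
  obtain ⟨f, Q, h1, h2⟩ := exists_velocity_sign hc (p := fun P => P)
    (u := fun _ => velocity (arcParam A) 0) hAc
    (fun f hf h0 => (C.transverse A hA _ (C.isArcParam hA) c hc f hf 0).1 h0) hσ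
  exact ⟨Q, f, h1, h2⟩

theorem exists_leavesTgt (C : ResConfig k) {A : OrientedArc} (hA : A ∈ C.arcs) {σ : SignType}
    (hσ : σ ≠ 0) : ∃ P, C.LeavesTgt A σ P := by
  obtain ⟨c, hc, hAc⟩ := C.tgt_mem A hA
  obtain ⟨f, Q, h1, h2⟩ := exists_velocity_sign hc (p := fun P => P)
    (u := fun _ => velocity (arcParam A) 1) hAc
    (fun f hf h0 => (C.transverse A hA _ (C.isArcParam hA) c hc f hf 0).2 h0) hσ
  exact ⟨Q, f, h1, h2⟩

theorem LeavesSrc.surgeryJoin {C : ResConfig k} {A : OrientedArc} (hA : A ∈ C.arcs) {σ : SignType}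
    {P Q : Sphere2} (hP : C.LeavesSrc A σ P) (hQ : C.LeavesTgt A σ Q) : C.SurgeryJoin P Q := by
  obtain ⟨f, hf, hfσ⟩ := hP
  obtain ⟨g, hg, hgσ⟩ := hQ
  exact ⟨A, hA, _, C.isArcParam hA, f, g, hf, hg, hfσ.trans hgσ.symm⟩

theorem SurgeryJoin.sameEnd {C : ResConfig k} {P Q : Sphere2} (h : C.SurgeryJoin P Q) :
    C.SameEnd P Q := .rel _ _ (Or.inr h)

/-- The ending circle that contains the side `σ` of the arc `A`. -/
def side (C : ResConfig k) (A : OrientedArc) (σ : SignType) : Set Sphere2 :=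
  {R | ∃ P, C.LeavesSrc A σ P ∧ C.SameEnd P R}

/-- Surgery joins every strand that leaves the initial point to the side `σ` with every strand that
leaves the final point to that side, so all of them lie on one ending circle. -/
theorem LeavesTgt.side_eq {C : ResConfig k} {A : OrientedArc} (hA : A ∈ C.arcs) {σ : SignType}
    (hσ : σ ≠ 0) {Q : Sphere2} (hQ : C.LeavesTgt A σ Q) : C.side A σ = C.endOf Q := by
  ext R
  constructor
  · rintro ⟨P, hP, hR⟩
    exact (hP.surgeryJoin hA hQ).sameEnd.symm.trans _ _ _ hR
  · intro hR
    obtain ⟨P, hP⟩ := C.exists_leavesSrc hA hσ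
    exact ⟨P, hP, (hP.surgeryJoin hA hQ).sameEnd.trans _ _ _ hR⟩

theorem LeavesSrc.side_eq {C : ResConfig k} {A : OrientedArc} (hA : A ∈ C.arcs) {σ : SignType}
    (hσ : σ ≠ 0) {P : Sphere2} (hP : C.LeavesSrc A σ P) : C.side A σ = C.endOf P := by
  obtain ⟨Q, hQ⟩ := C.exists_leavesTgt hA hσ
  rw [hQ.side_eq hA hσ]
  exact (SameEnd.endOf_eq (hP.surgeryJoin hA hQ).sameEnd).symm

theorem side_mem_ends (C : ResConfig k) {A : OrientedArc} (hA : A ∈ C.arcs) {σ : SignType}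
    (hσ : σ ≠ 0) : C.side A σ ∈ C.ends := by
  obtain ⟨P, hP⟩ := C.exists_leavesSrc hA hσ
  rw [hP.side_eq hA hσ]
  obtain ⟨f, hf, -⟩ := hP
  obtain ⟨c, hc, -, hPc⟩ := hf.mem
  exact C.endOf_mem_ends ⟨c, hc, hPc⟩ hf.not_mem_feet

/-- The circle `x` and the ending circle `y` have a point in common. -/
def Meets (x y : Set Sphere2) : Prop := (x ∩ y).Nonempty

theorem meets_src_side (C : ResConfig k) {A : OrientedArc} (hA : A ∈ C.arcs) {σ : SignType}
    (hσ : σ ≠ 0) : Meets (C.circleAt A.src) (C.side A σ) := by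
  obtain ⟨P, hP⟩ := C.exists_leavesSrc hA hσ
  obtain ⟨f, hf, -⟩ := id hP
  obtain ⟨c, hc, hAc, hPc⟩ := hf.mem
  exact ⟨P, by rwa [circleAt_eq hc hAc], P, hP, .refl _⟩

theorem meets_tgt_side (C : ResConfig k) {A : OrientedArc} (hA : A ∈ C.arcs) {σ : SignType}
    (hσ : σ ≠ 0) : Meets (C.circleAt A.tgt) (C.side A σ) := by
  obtain ⟨P, hP⟩ := C.exists_leavesTgt hA hσ
  obtain ⟨f, hf, -⟩ := id hP
  obtain ⟨c, hc, hAc, hPc⟩ := hf.mem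
  exact ⟨P, by rwa [circleAt_eq hc hAc], by rw [hP.side_eq hA hσ]; exact C.mem_endOf P⟩

/-- The two pieces of circle at a foot of an arc belong to the two sides of the arc. -/
theorem linked_of_leads {C : ResConfig k} {c : Set Sphere2} (hc : c ∈ C.circles)
    {f : ℝ → Sphere2} (hf : IsCircleParam c f) {s : ℝ} (hs : f s ∈ C.feet) {P Q : Sphere2}
    (hP : C.Leads (fun t => f (s - t)) (f s) P) (hQ : C.Leads (fun t => f (t + s)) (f s) Q) :
    EdgeLinked C.arcs (C.side · 1) (C.side · (-1)) (C.endOf P) (C.endOf Q) := by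
  -- The two strands have opposite velocities at the foot, so they leave it to opposite sides of the
  -- arc. Which side is which does not matter, as linking is symmetric.
  suffices h : ∃ A ∈ C.arcs, ∃ σ ≠ 0, C.side A (-σ) = C.endOf P ∧ C.side A σ = C.endOf Q by
    obtain ⟨A, hA, σ, hσ, h1, h2⟩ := h
    rcases SignType.eq_one_or_eq_neg_one hσ with rfl | rfl
    · exact .symm _ _ (.rel _ _ ⟨A, hA, h2, h1⟩)
    · exact .rel _ _ ⟨A, hA, by simpa using h1, h2⟩
  obtain ⟨A, hA, h⟩ := hs
  rcases h with h | h
  · have hne := (C.transverse A hA _ (C.isArcParam hA) c hc f hf s).1 h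
    refine ⟨A, hA, _, sign_ne_zero.2 hne, LeavesSrc.side_eq hA ?_ ⟨_, h ▸ hP, ?_⟩,
      LeavesSrc.side_eq hA (sign_ne_zero.2 hne) ⟨_, h ▸ hQ, ?_⟩⟩
    · simpa using hne
    · rw [velocity_comp_const_sub, det3_neg, sub_zero, Left.sign_neg]
    · rw [velocity_comp_add_const, zero_add]
  · have hne := (C.transverse A hA _ (C.isArcParam hA) c hc f hf s).2 h
    refine ⟨A, hA, _, sign_ne_zero.2 hne, LeavesTgt.side_eq hA ?_ ⟨_, h ▸ hP, ?_⟩,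
      LeavesTgt.side_eq hA (sign_ne_zero.2 hne) ⟨_, h ▸ hQ, ?_⟩⟩
    · simpa using hne
    · rw [velocity_comp_const_sub, det3_neg, sub_zero, Left.sign_neg]
    · rw [velocity_comp_add_const, zero_add]

/-- Induction on the number of feet passed before the time `t`. The last of them, at time `s`, is
crossed by `linked_of_leads` from a time `u` shortly before it; if there are none, both points lie
on the same edge. -/
theorem linked_endOf_param {C : ResConfig k} {c : Set Sphere2} (hc : c ∈ C.circles)
    {f : ℝ → Sphere2} (hf : IsCircleParam c f) (h0 : f 0 ∉ C.feet) (n : ℕ) {t : ℝ}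
    (ht : t ∈ Set.Ico (0 : ℝ) 1) (hft : f t ∉ C.feet)
    (hn : {u | (u ∈ Set.Ico (0 : ℝ) 1 ∧ f u ∈ C.feet) ∧ u < t}.ncard = n) :
    EdgeLinked C.arcs (C.side · 1) (C.side · (-1)) (C.endOf (f 0)) (C.endOf (f t)) := by
  induction n using Nat.strong_induction_on generalizing t with
  | _ n ih =>
  have hfin := (C.finite_foot_times hf)
  have hSfin := hfin.subset (t := {u | (u ∈ Set.Ico (0 : ℝ) 1 ∧ f u ∈ C.feet) ∧ u < t})
    fun u hu => hu.1
  by_cases hS : {u | (u ∈ Set.Ico (0 : ℝ) 1 ∧ f u ∈ C.feet) ∧ u < t}.Nonempty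
  · obtain ⟨s, hs, hmax⟩ := Set.exists_max_image _ id hSfin hS
    obtain ⟨⟨hs01, hsf⟩, hst⟩ := hs
    have hs0 : 0 < s := lt_of_le_of_ne hs01.1 fun h => h0 (h ▸ hsf)
    obtain ⟨u, hu0, hus, hu⟩ := hfin.exists_gap_below hs0
    have hfu : ∀ v ∈ Set.Ico u s, f v ∉ C.feet := fun v hv hvf =>
      (hu v ⟨⟨hu0.le.trans hv.1, hv.2.trans hs01.2⟩, hvf⟩ hv.2).not_ge hv.1
    have h1 := ih _ (by
      rw [← hn]
      refine Set.ncard_lt_ncard ⟨fun v hv => ⟨hv.1, by linarith [hv.2]⟩, fun hsub => ?_⟩ hSfin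
      exact absurd (hsub ⟨⟨hs01, hsf⟩, hst⟩).2 (not_lt.2 hus.le))
      (t := u) ⟨hu0.le, hus.trans hs01.2⟩ (hfu u ⟨le_rfl, hus⟩) rfl
    refine h1.trans _ _ _ (linked_of_leads hc hf hsf ?_ ?_)
    · refine ⟨⟨c, hc, hf.reverse s⟩, s - u, by linarith, by simp, by simp, fun v hv => ?_⟩
      exact hfu _ ⟨by linarith [hv.2], by linarith [hv.1]⟩
    · refine ⟨⟨c, hc, hf.shift s⟩, t - s, by linarith, by simp, by simp, fun v hv hvf => ?_⟩
      rcases eq_or_lt_of_le hv.2 with rfl | hlt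
      · exact hft (by simpa using hvf)
      · have := hmax (v + s) ⟨⟨⟨by linarith [hv.1], by linarith [ht.2]⟩, hvf⟩, by linarith⟩
        simp only [id] at this
        linarith [hv.1]
  · rw [SameEnd.endOf_eq (C := C) (P := f 0) (Q := f t)]
    · exact .refl _
    · refine .rel _ _ (Or.inl ⟨c, hc, f, hf, t, ht.1, rfl, rfl, fun u hu huf => ?_⟩)
      rcases eq_or_lt_of_le hu.2 with rfl | hlt
      · exact hft huf
      · exact hS ⟨u, ⟨⟨hu.1, hlt.trans ht.2⟩, huf⟩, hlt⟩

/-! ### The incidence structure of a configuration -/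

/-- Two ending circles that meet the same starting circle are linked by arcs. -/
theorem linked_ends_of_meets {C : ResConfig k} {c : Set Sphere2} (hc : c ∈ C.circles)
    {y y' : Set Sphere2} (hy : y ∈ C.ends) (hy' : y' ∈ C.ends) (h : Meets c y) (h' : Meets c y') :
    EdgeLinked C.arcs (C.side · 1) (C.side · (-1)) y y' := by
  obtain ⟨P, hPc, hPy⟩ := h
  obtain ⟨Q, hQc, hQy⟩ := h'
  obtain ⟨f, hf, rfl⟩ := C.exists_param_at hc hPc
  obtain ⟨t, ht, rfl⟩ := hf.exists_mem_Ico hQc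
  rw [eq_endOf hy hPy, eq_endOf hy' hQy]
  exact linked_endOf_param hc hf (mem_support_of_mem_end hy hPy).2 _ ht
    (mem_support_of_mem_end hy' hQy).2 rfl

/-- Two starting circles that meet the same ending circle are linked by arcs. -/
theorem linked_circles_of_meets {C : ResConfig k} {c d : Set Sphere2} (hc : c ∈ C.circles)
    (hd : d ∈ C.circles) {y : Set Sphere2} (hy : y ∈ C.ends) (h : Meets c y) (h' : Meets d y) :
    EdgeLinked C.arcs (fun A => C.circleAt A.src) (fun A => C.circleAt A.tgt) c d := by
  obtain ⟨P, hPc, hPy⟩ := h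
  obtain ⟨Q, hQd, hQy⟩ := h'
  rw [eq_endOf hy hPy] at hQy
  -- In terms of `circleAt` the claim depends on `P` and `Q` alone and can be proved by induction
  -- along `SameEnd`: an edge stays on its circle, and a surgery join follows an arc.
  rw [← circleAt_eq hc hPc, ← circleAt_eq hd hQd]
  replace hQy : C.SameEnd P Q := hQy
  clear hPc hQd hPy
  induction hQy with
  | rel P Q h =>
    rcases h with h | ⟨A, hA, -, -, f, g, hf, hg, -⟩
    · obtain ⟨c, hc, hP, hQ⟩ := h.mem
      rw [circleAt_eq hc hP, circleAt_eq hc hQ]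
      exact .refl _
    · obtain ⟨c, hc, hA1, hP⟩ := hf.mem
      obtain ⟨d, hd, hA2, hQ⟩ := hg.mem
      exact .rel _ _ ⟨A, hA, (circleAt_eq hc hA1).trans (circleAt_eq hc hP).symm,
        (circleAt_eq hd hA2).trans (circleAt_eq hd hQ).symm⟩
  | refl => exact .refl _
  | symm _ _ _ ih => exact ih.symm
  | trans _ _ _ _ _ ih1 ih2 => exact ih1.trans _ _ _ ih2

theorem exists_end_meets {C : ResConfig k} {c : Set Sphere2} (hc : c ∈ C.circles) :
    ∃ y ∈ C.ends, Meets c y := by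
  obtain ⟨f, hf⟩ := C.circle_smooth c hc
  obtain ⟨P, hP⟩ := C.exists_leads hc hf
  obtain ⟨d, hd, h0, hPd⟩ := hP.mem
  obtain rfl := C.circle_eq_of_mem hc hd (hf.mem 0) h0
  exact ⟨C.endOf P, C.endOf_mem_ends ⟨c, hc, hPd⟩ hP.not_mem_feet, P, hPd, C.mem_endOf P⟩

theorem exists_circle_meets {C : ResConfig k} {y : Set Sphere2} (hy : y ∈ C.ends) :
    ∃ c ∈ C.circles, Meets c y := by
  obtain ⟨P, ⟨c, hc, hP⟩, -, rfl⟩ := id hy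
  exact ⟨c, hc, P, hP, C.mem_endOf P⟩

/-- With one ending circle chosen for each starting circle, any other one meeting that circle is
linked to the chosen one, hence is a side of an arc. -/
theorem ends_finite (C : ResConfig k) : C.ends.Finite := by
  choose! f hf hfm using fun c => exists_end_meets (C := C) (c := c)
  refine ((C.circles.finite_toSet.image f).union
    ((C.arcs.finite_toSet.image (C.side · 1)).union
      (C.arcs.finite_toSet.image (C.side · (-1))))).subset fun y hy => ?_
  obtain ⟨c, hc, hm⟩ := exists_circle_meets hy
  have key : ∀ y y', EdgeLinked C.arcs (C.side · 1) (C.side · (-1)) y y' → y = y' ∨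
      (y ∈ ((C.side · 1) '' C.arcs) ∪ ((C.side · (-1)) '' C.arcs) ∧
        y' ∈ ((C.side · 1) '' C.arcs) ∪ ((C.side · (-1)) '' C.arcs)) := fun y y' h => by
    induction h with
    | rel y y' h =>
      obtain ⟨A, hA, rfl, rfl⟩ := h
      exact Or.inr ⟨Or.inl ⟨A, hA, rfl⟩, Or.inr ⟨A, hA, rfl⟩⟩
    | refl => exact Or.inl rfl
    | symm _ _ _ ih => exact ih.imp Eq.symm And.symm
    | trans _ _ _ _ _ ih1 ih2 =>
      rcases ih1 with rfl | ih1
      · exact ih2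
      · rcases ih2 with rfl | ih2
        · exact Or.inr ih1
        · exact Or.inr ⟨ih1.1, ih2.2⟩
  rcases key _ _ (linked_ends_of_meets hc hy (hf c hc) hm (hfm c hc)) with rfl | h
  · exact Or.inl ⟨c, hc, rfl⟩
  · exact Or.inr h.1

/-- The passage from geometry to counting. The sides `1` and `-1` of an arc act as the two ends of
its dual arc. -/
theorem isIncidence (C : ResConfig k) :
    IsIncidence C.circles C.ends_finite.toFinset C.arcs (fun A => C.circleAt A.src)
      (fun A => C.circleAt A.tgt) (C.side · 1) (C.side · (-1)) Meets where
  s_mem A hA := (circleAt_spec (C.src_mem A hA)).1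
  t_mem A hA := (circleAt_spec (C.tgt_mem A hA)).1
  l_mem A hA := C.ends_finite.mem_toFinset.2 (C.side_mem_ends hA (by decide))
  r_mem A hA := C.ends_finite.mem_toFinset.2 (C.side_mem_ends hA (by decide))
  s_l A hA := C.meets_src_side hA (by decide)
  s_r A hA := C.meets_src_side hA (by decide)
  t_l A hA := C.meets_tgt_side hA (by decide)
  t_r A hA := C.meets_tgt_side hA (by decide)
  exists_right x hx := by
    simpa only [Set.Finite.mem_toFinset] using exists_end_meets hx
  exists_left y hy := exists_circle_meets (C.ends_finite.mem_toFinset.1 hy)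
  linked_left x hx x' hx' y hy :=
    linked_circles_of_meets hx hx' (C.ends_finite.mem_toFinset.1 hy)
  linked_right x hx y hy y' hy' :=
    linked_ends_of_meets hx (C.ends_finite.mem_toFinset.1 hy) (C.ends_finite.mem_toFinset.1 hy')

end ResConfig

/-! ### Unions of components -/

namespace ResConfig

variable {k m : ℕ}

/-- `D` consists of some circles of `C` together with all the arcs of `C` that touch them, and these
arcs touch no other circles. -/
structure IsClosedIn (D : ResConfig m) (C : ResConfig k) : Prop where
  circles_subset : D.circles ⊆ C.circles
  arcs_subset : D.arcs ⊆ C.arcs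
  src_closed : ∀ A ∈ C.arcs, A.src ∈ D.support → A ∈ D.arcs
  tgt_closed : ∀ A ∈ C.arcs, A.tgt ∈ D.support → A ∈ D.arcs

namespace IsClosedIn

variable {D : ResConfig m} {C : ResConfig k}

theorem mem_circles (h : D.IsClosedIn C) {c : Set Sphere2} (hc : c ∈ C.circles) {P : Sphere2}
    (hP : P ∈ c) (hPD : P ∈ D.support) : c ∈ D.circles := by
  obtain ⟨d, hd, hPd⟩ := hPD
  rwa [C.circle_eq_of_mem hc (h.circles_subset hd) hP hPd]

theorem mem_feet_iff (h : D.IsClosedIn C) {P : Sphere2} (hP : P ∈ D.support) :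
    P ∈ D.feet ↔ P ∈ C.feet := by
  constructor
  · rintro ⟨A, hA, hPA⟩
    exact ⟨A, h.arcs_subset hA, hPA⟩
  · rintro ⟨A, hA, rfl | rfl⟩
    · exact ⟨A, h.src_closed A hA hP, Or.inl rfl⟩
    · exact ⟨A, h.tgt_closed A hA hP, Or.inr rfl⟩

theorem sameEdge_iff (h : D.IsClosedIn C) {P Q : Sphere2} :
    D.SameEdge P Q ↔ C.SameEdge P Q ∧ P ∈ D.support := by
  constructor
  · rintro ⟨c, hc, f, hf, r, hr, rfl, rfl, hfeet⟩
    exact ⟨⟨c, h.circles_subset hc, f, hf, r, hr, rfl, rfl, fun t ht hft =>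
      hfeet t ht ((h.mem_feet_iff ⟨c, hc, hf.mem t⟩).2 hft)⟩, c, hc, hf.mem 0⟩
  · rintro ⟨⟨c, hc, f, hf, r, hr, rfl, rfl, hfeet⟩, hP⟩
    have hcD := h.mem_circles hc (hf.mem 0) hP
    exact ⟨c, hcD, f, hf, r, hr, rfl, rfl, fun t ht hft =>
      hfeet t ht ((h.mem_feet_iff ⟨c, hcD, hf.mem t⟩).1 hft)⟩

theorem leads_iff (h : D.IsClosedIn C) {f : ℝ → Sphere2} {p P : Sphere2} :
    D.Leads f p P ↔ C.Leads f p P ∧ p ∈ D.support := by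
  constructor
  · rintro ⟨⟨c, hc, hf⟩, r, hr, rfl, rfl, hfeet⟩
    exact ⟨⟨⟨c, h.circles_subset hc, hf⟩, r, hr, rfl, rfl, fun t ht hft =>
      hfeet t ht ((h.mem_feet_iff ⟨c, hc, hf.mem t⟩).2 hft)⟩, c, hc, hf.mem 0⟩
  · rintro ⟨⟨⟨c, hc, hf⟩, r, hr, rfl, rfl, hfeet⟩, hP⟩
    have hcD := h.mem_circles hc (hf.mem 0) hP
    exact ⟨⟨c, hcD, hf⟩, r, hr, rfl, rfl, fun t ht hft =>
      hfeet t ht ((h.mem_feet_iff ⟨c, hcD, hf.mem t⟩).1 hft)⟩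

theorem src_mem_support_iff (h : D.IsClosedIn C) {A : OrientedArc} (hA : A ∈ C.arcs) :
    A.src ∈ D.support ↔ A.tgt ∈ D.support :=
  ⟨fun hs => D.tgt_mem A (h.src_closed A hA hs), fun ht => D.src_mem A (h.tgt_closed A hA ht)⟩

theorem _root_.ResConfig.Leads.mem_support_iff (h : D.IsClosedIn C) {f : ℝ → Sphere2}
    {p P : Sphere2} (hf : C.Leads f p P) : p ∈ D.support ↔ P ∈ D.support := by
  obtain ⟨c, hc, hp, hP⟩ := hf.mem
  exact ⟨fun hs => ⟨c, h.mem_circles hc hp hs, hP⟩, fun hs => ⟨c, h.mem_circles hc hP hs, hp⟩⟩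

/-- Both claims are proved together, because symmetry and transitivity need the first one to carry
the assumption of the second to another point. -/
theorem sameEnd_of_sameEnd (h : D.IsClosedIn C) {P Q : Sphere2} (hPQ : C.SameEnd P Q) :
    (P ∈ D.support ↔ Q ∈ D.support) ∧ (P ∈ D.support → D.SameEnd P Q) := by
  induction hPQ with
  | rel P Q hPQ =>
    rcases hPQ with hPQ | ⟨A, hA, γ, hγ, f, g, hf, hg, hσ⟩
    · obtain ⟨c, hc, hP, hQ⟩ := hPQ.mem
      exact ⟨⟨fun hs => ⟨c, h.mem_circles hc hP hs, hQ⟩, fun hs => ⟨c, h.mem_circles hc hQ hs, hP⟩⟩,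
        fun hs => .rel _ _ (Or.inl (h.sameEdge_iff.2 ⟨hPQ, hs⟩))⟩
    · have h1 := Leads.mem_support_iff h hf
      have h2 := Leads.mem_support_iff h hg
      have h3 := h.src_mem_support_iff hA
      refine ⟨h1.symm.trans (h3.trans h2), fun hs => SurgeryJoin.sameEnd ?_⟩
      exact ⟨A, h.src_closed A hA (h1.2 hs), γ, hγ, f, g, h.leads_iff.2 ⟨hf, h1.2 hs⟩,
        h.leads_iff.2 ⟨hg, h3.1 (h1.2 hs)⟩, hσ⟩
  | refl => exact ⟨Iff.rfl, fun _ => .refl _⟩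
  | symm _ _ _ ih => exact ⟨ih.1.symm, fun hs => (ih.2 (ih.1.2 hs)).symm⟩
  | trans _ _ _ _ _ ih1 ih2 =>
    exact ⟨ih1.1.trans ih2.1, fun hs => (ih1.2 hs).trans _ _ _ (ih2.2 (ih1.1.1 hs))⟩

theorem sameEnd_mono (h : D.IsClosedIn C) {P Q : Sphere2} (hPQ : D.SameEnd P Q) :
    C.SameEnd P Q := by
  refine Relation.EqvGen.mono (fun P Q hPQ => ?_) _ _ hPQ
  rcases hPQ with hPQ | ⟨A, hA, γ, hγ, f, g, hf, hg, hσ⟩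
  · exact Or.inl (h.sameEdge_iff.1 hPQ).1
  · exact Or.inr ⟨A, h.arcs_subset hA, γ, hγ, f, g, (h.leads_iff.1 hf).1, (h.leads_iff.1 hg).1, hσ⟩

/-- Ending circles are recorded as sets of points, so those of `D` are literally ending circles of
`C` and need no identification. -/
theorem endOf_eq (h : D.IsClosedIn C) {P : Sphere2} (hP : P ∈ D.support) :
    D.endOf P = C.endOf P :=
  Set.ext fun _ => ⟨h.sameEnd_mono, fun hQ => (h.sameEnd_of_sameEnd hQ).2 hP⟩

/-- The ending circles of `D` are those ending circles of `C` that meet circles of `D`. -/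
theorem mem_ends_iff (h : D.IsClosedIn C) {y : Set Sphere2} :
    y ∈ D.ends ↔ y ∈ C.ends ∧ ∃ c ∈ D.circles, Meets c y := by
  constructor
  · rintro ⟨P, hP, hPf, rfl⟩
    refine ⟨?_, ?_⟩
    · change D.endOf P ∈ C.ends
      rw [h.endOf_eq hP]
      obtain ⟨c, hc, hPc⟩ := id hP
      exact C.endOf_mem_ends ⟨c, h.circles_subset hc, hPc⟩ (hPf ∘ (h.mem_feet_iff hP).2)
    · obtain ⟨c, hc, hPc⟩ := hP
      exact ⟨c, hc, P, hPc, D.mem_endOf P⟩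
  · rintro ⟨hy, c, hc, P, hPc, hPy⟩
    have hP : P ∈ D.support := ⟨c, hc, hPc⟩
    rw [eq_endOf hy hPy, ← h.endOf_eq hP]
    exact D.endOf_mem_ends hP ((mem_support_of_mem_end hy hPy).2 ∘ (h.mem_feet_iff hP).1)

theorem linked_of_linked (h : D.IsClosedIn C) {c d : Set Sphere2} (hcd : C.Linked c d) :
    (c ∈ D.circles ↔ d ∈ D.circles) ∧ (c ∈ D.circles → D.Linked c d) := by
  induction hcd with
  | rel c d hcd =>
    obtain ⟨hc, hd, A, hA, hAc, hAd⟩ := hcd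
    have h1 : c ∈ D.circles ↔ d ∈ D.circles :=
      ⟨fun hcD => h.mem_circles hd hAd ((h.src_mem_support_iff hA).1 ⟨c, hcD, hAc⟩),
        fun hdD => h.mem_circles hc hAc ((h.src_mem_support_iff hA).2 ⟨d, hdD, hAd⟩)⟩
    exact ⟨h1, fun hcD =>
      .rel _ _ ⟨hcD, h1.1 hcD, A, h.src_closed A hA ⟨c, hcD, hAc⟩, hAc, hAd⟩⟩
  | refl => exact ⟨Iff.rfl, fun _ => .refl _⟩
  | symm _ _ _ ih => exact ⟨ih.1.symm, fun hs => (ih.2 (ih.1.2 hs)).symm⟩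
  | trans _ _ _ _ _ ih1 ih2 =>
    exact ⟨ih1.1.trans ih2.1, fun hs => (ih1.2 hs).trans _ _ _ (ih2.2 (ih1.1.1 hs))⟩

end IsClosedIn

theorem linked_iff_edgeLinked (C : ResConfig k) {c d : Set Sphere2} :
    C.Linked c d ↔
      EdgeLinked C.arcs (fun A => C.circleAt A.src) (fun A => C.circleAt A.tgt) c d := by
  suffices h : (fun c d => c ∈ C.circles ∧ d ∈ C.circles ∧ ∃ A ∈ C.arcs, A.src ∈ c ∧ A.tgt ∈ d) =
      fun c d => ∃ A ∈ C.arcs, C.circleAt A.src = c ∧ C.circleAt A.tgt = d by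
    unfold Linked EdgeLinked
    rw [h]
  ext c d
  constructor
  · rintro ⟨hc, hd, A, hA, hAc, hAd⟩
    exact ⟨A, hA, circleAt_eq hc hAc, circleAt_eq hd hAd⟩
  · rintro ⟨A, hA, rfl, rfl⟩
    have hs := circleAt_spec (C.src_mem A hA)
    have ht := circleAt_spec (C.tgt_mem A hA)
    exact ⟨hs.1, ht.1, A, hA, hs.2, ht.2⟩

/-! ### The active part and the passive circles -/

theorem mem_active_circles (C : ResConfig k) {c : Set Sphere2} :
    c ∈ C.active.circles ↔ c ∈ C.circles ∧ c ∉ C.passive := by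
  classical exact Finset.mem_filter

theorem mem_passive (C : ResConfig k) {c : Set Sphere2} :
    c ∈ C.passive ↔ c ∈ C.circles ∧ ∀ A ∈ C.arcs, Disjoint A.carrier c := by
  classical exact Finset.mem_filter

theorem active_isClosedIn (C : ResConfig k) : C.active.IsClosedIn C where
  circles_subset _ hc := (C.mem_active_circles.1 hc).1
  arcs_subset := subset_rfl
  src_closed _ hA _ := hA
  tgt_closed _ hA _ := hA

/-- A circle that is not passive contains an endpoint of an arc. -/
theorem exists_foot_of_mem_active (C : ResConfig k) {c : Set Sphere2}
    (hc : c ∈ C.active.circles) : ∃ A ∈ C.arcs, A.src ∈ c ∨ A.tgt ∈ c := by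
  obtain ⟨hcC, hcp⟩ := C.mem_active_circles.1 hc
  by_contra! hno
  refine hcp (C.mem_passive.2 ⟨hcC, fun A hA => Set.disjoint_left.2 fun P hPA hPc => ?_⟩)
  rcases C.interior_disjoint A hA c hcC ⟨hPA, hPc⟩ with rfl | rfl
  · exact (hno A hA).1 hPc
  · exact (hno A hA).2 hPc

theorem not_mem_feet_of_mem_passive (C : ResConfig k) {c : Set Sphere2} (hc : c ∈ C.passive)
    {P : Sphere2} (hP : P ∈ c) : P ∉ C.feet := by
  rintro ⟨A, hA, rfl | rfl⟩
  · exact Set.disjoint_left.1 ((C.mem_passive.1 hc).2 A hA) (C.src_mem_carrier hA) hP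
  · exact Set.disjoint_left.1 ((C.mem_passive.1 hc).2 A hA) (C.tgt_mem_carrier hA) hP

/-- A passive circle is an ending circle. -/
theorem endOf_of_mem_passive (C : ResConfig k) {c : Set Sphere2} (hc : c ∈ C.passive)
    {P : Sphere2} (hP : P ∈ c) : C.endOf P = c := by
  have hcC := (C.mem_passive.1 hc).1
  have hPa : P ∉ C.active.support := by
    rintro ⟨d, hd, hPd⟩
    obtain ⟨hdC, hdp⟩ := C.mem_active_circles.1 hd
    exact hdp (C.circle_eq_of_mem hcC hdC hP hPd ▸ hc)
  -- A strand that leaves a foot stays on a circle with a foot, so surgery joins never reach `c`;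
  -- conversely all of `c` is a single edge.
  have hjoin : ∀ {f p Q}, C.Leads f p Q → p ∈ C.feet → Q ∉ c := fun hf hp hQ => by
    obtain ⟨d, hd, hpd, hQd⟩ := hf.mem
    exact C.not_mem_feet_of_mem_passive hc (C.circle_eq_of_mem hd hcC hQd hQ ▸ hpd) hp
  have key : ∀ P Q, C.SameEnd P Q → (P ∈ c ↔ Q ∈ c) := fun P Q h => by
    induction h with
    | rel P Q h =>
      rcases h with h | ⟨A, hA, -, -, f, g, hf, hg, -⟩
      · obtain ⟨d, hd, hPd, hQd⟩ := h.mem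
        exact ⟨fun h => C.circle_eq_of_mem hd hcC hPd h ▸ hQd,
          fun h => C.circle_eq_of_mem hd hcC hQd h ▸ hPd⟩
      · exact iff_of_false (hjoin hf ⟨A, hA, Or.inl rfl⟩) (hjoin hg ⟨A, hA, Or.inr rfl⟩)
    | refl => rfl
    | symm _ _ _ ih => exact ih.symm
    | trans _ _ _ _ _ ih1 ih2 => exact ih1.trans ih2
  ext Q
  refine ⟨fun h => (key P Q h).1 hP, fun hQ => ?_⟩
  obtain ⟨f, hf, rfl⟩ := C.exists_param_at hcC hP
  obtain ⟨t, ht, rfl⟩ := hf.exists_mem_Ico hQ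
  exact .rel _ _ (Or.inl ⟨c, hcC, f, hf, t, ht.1, rfl, rfl, fun u _ =>
    C.not_mem_feet_of_mem_passive hc (hf.mem u)⟩)

theorem mem_active_ends_or_mem_passive (C : ResConfig k) {y : Set Sphere2} (hy : y ∈ C.ends) :
    y ∈ C.active.ends ∨ y ∈ C.passive := by
  obtain ⟨c, hc, P, hPc, hPy⟩ := exists_circle_meets hy
  by_cases hcp : c ∈ C.passive
  · right
    rwa [eq_endOf hy hPy, C.endOf_of_mem_passive hcp hPc]
  · exact Or.inl (C.active_isClosedIn.mem_ends_iff.2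
      ⟨hy, c, C.mem_active_circles.2 ⟨hc, hcp⟩, P, hPc, hPy⟩)

/-! ### The components of a configuration -/

open scoped Classical in
/-- The set of circles of the component of the circle `c`. -/
noncomputable def component (C : ResConfig k) (c : Set Sphere2) : Finset (Set Sphere2) :=
  C.circles.filter (fun d => C.Linked c d)

theorem mem_components (C : ResConfig k) {K : Finset (Set Sphere2)} :
    K ∈ C.components ↔ ∃ c ∈ C.circles, C.component c = K := by
  classical exact Finset.mem_image

theorem mem_restrict_component_circles (C : ResConfig k) {c d : Set Sphere2} :
    d ∈ (C.restrict (C.component c)).circles ↔ d ∈ C.circles ∧ C.Linked c d := by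
  classical
  simp only [restrict, component, Finset.mem_filter, and_self_left]

theorem restrict_component_isClosedIn (C : ResConfig k) (c : Set Sphere2) :
    (C.restrict (C.component c)).IsClosedIn C := by
  classical
  have hmem : ∀ {d}, d ∈ C.component c ↔ d ∈ C.circles ∧ C.Linked c d := Finset.mem_filter
  refine ⟨Finset.filter_subset _ _, Finset.filter_subset _ _, fun A hA h => ?_, fun A hA h => ?_⟩
  · obtain ⟨d, hd, hAd⟩ := h
    obtain ⟨hdC, hcd⟩ := C.mem_restrict_component_circles.1 hd
    obtain ⟨e, he, hAe⟩ := C.tgt_mem A hA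
    exact Finset.mem_filter.2 ⟨hA, ⟨d, hdC, hmem.2 ⟨hdC, hcd⟩, hAd⟩, e, he,
      hmem.2 ⟨he, hcd.trans _ _ _ (.rel _ _ ⟨hdC, he, A, hA, hAd, hAe⟩)⟩, hAe⟩
  · obtain ⟨d, hd, hAd⟩ := h
    obtain ⟨hdC, hcd⟩ := C.mem_restrict_component_circles.1 hd
    obtain ⟨e, he, hAe⟩ := C.src_mem A hA
    exact Finset.mem_filter.2 ⟨hA, ⟨e, he, hmem.2 ⟨he, hcd.trans _ _ _
      (Relation.EqvGen.rel _ _ ⟨he, hdC, A, hA, hAe, hAd⟩).symm⟩, hAe⟩,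
      d, hdC, hmem.2 ⟨hdC, hcd⟩, hAd⟩

theorem restrict_component_connected (C : ResConfig k) {c : Set Sphere2} (hc : c ∈ C.circles) :
    (C.restrict (C.component c)).Connected := by
  refine ⟨⟨c, C.mem_restrict_component_circles.2 ⟨hc, .refl _⟩⟩, fun d hd e he => ?_⟩
  obtain ⟨-, hd'⟩ := C.mem_restrict_component_circles.1 hd
  obtain ⟨-, he'⟩ := C.mem_restrict_component_circles.1 he
  exact ((C.restrict_component_isClosedIn c).linked_of_linked
    (hd'.symm.trans _ _ _ he')).2 hd

theorem mem_restrict_component_ends (C : ResConfig k) {c y : Set Sphere2} :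
    y ∈ (C.restrict (C.component c)).ends ↔
      y ∈ C.ends ∧ ∃ d ∈ C.circles, C.Linked c d ∧ Meets d y := by
  simp only [(C.restrict_component_isClosedIn c).mem_ends_iff, mem_restrict_component_circles,
    and_assoc]

/-! ### Pairs of monomials compatible with trees and dual trees -/

/-- The condition under which the coefficient `treeCoeff` is non-zero. -/
def IsTreePair (T : ResConfig k) (a b : Finset (Set Sphere2)) : Prop :=
  (T.IsTree ∧ (∀ x ∈ T.circles, x ∈ a) ∧ ∀ y ∈ T.ends, y ∈ b) ∨
    (T.IsDualTree ∧ (∀ x ∈ T.circles, x ∉ a) ∧ ∀ y ∈ T.ends, y ∉ b)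

/-- If `b` contains the ending circles that meet `a` and the degree is as large as it can be, then
all components are trees contained in `a` and `b` or dual trees disjoint from `a` and `b`. -/
theorem isTreePair_of_degree (C : ResConfig k) {a b : Finset (Set Sphere2)} (ha : a ⊆ C.circles)
    (hb : ∀ y ∈ b, y ∈ C.ends) (hab : ∀ x ∈ a, ∀ y ∈ C.ends, Meets x y → y ∈ b)
    (hdeg : ((C.ends.ncard : ℤ) - 2 * b.card) - (C.circles.card - 2 * a.card) = k)
    {K : Finset (Set Sphere2)} (hK : K ∈ C.components) : (C.restrict K).IsTreePair a b := by
  classical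
  obtain ⟨c, hc, rfl⟩ := C.mem_components.1 hK
  have hX : C.circles.filter (fun d => EdgeLinked C.arcs (fun A => C.circleAt A.src)
      (fun A => C.circleAt A.tgt) c d) = (C.restrict (C.component c)).circles := by
    ext d
    rw [mem_restrict_component_circles, Finset.mem_filter, linked_iff_edgeLinked]
  have hY : ((C.ends_finite.toFinset.filter fun y => ∃ d, EdgeLinked C.arcs
      (fun A => C.circleAt A.src) (fun A => C.circleAt A.tgt) c d ∧ Meets d y : Finset _) :
      Set (Set Sphere2)) = (C.restrict (C.component c)).ends := by
    ext y
    rw [mem_restrict_component_ends, Finset.mem_coe, Finset.mem_filter, Set.Finite.mem_toFinset]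
    simp only [← linked_iff_edgeLinked]
    -- The condition `d ∈ C.circles` is automatic, because links starting at a circle of `C` lead
    -- only to circles of `C`.
    refine and_congr_right fun hy => exists_congr fun d => ⟨fun h => ⟨?_, h⟩, fun h => h.2⟩
    rw [linked_iff_edgeLinked] at h
    exact (C.isIncidence.mem_of_linked h.1).1 hc
  have hA : C.arcs.filter (fun A => EdgeLinked C.arcs (fun A => C.circleAt A.src)
      (fun A => C.circleAt A.tgt) c (C.circleAt A.src)) = (C.restrict (C.component c)).arcs := by
    ext A
    rw [Finset.mem_filter]
    constructor
    · rintro ⟨hA, hl⟩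
      have hs := circleAt_spec (C.src_mem A hA)
      exact (C.restrict_component_isClosedIn c).src_closed A hA ⟨_,
        C.mem_restrict_component_circles.2 ⟨hs.1, C.linked_iff_edgeLinked.2 hl⟩, hs.2⟩
    · intro hA
      have hAC := (C.restrict_component_isClosedIn c).arcs_subset hA
      obtain ⟨d, hd, hAd⟩ := (C.restrict (C.component c)).src_mem A hA
      obtain ⟨hdC, hcd⟩ := C.mem_restrict_component_circles.1 hd
      rw [circleAt_eq hdC hAd]
      exact ⟨hAC, C.linked_iff_edgeLinked.1 hcd⟩
  have key := C.isIncidence.tree_or_dual_tree ha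
    (fun y hy => C.ends_finite.mem_toFinset.2 (hb y hy))
    (fun x hx y hy => hab x hx y (C.ends_finite.mem_toFinset.1 hy))
    (by rw [← Set.ncard_eq_toFinset_card _ C.ends_finite, C.card_arcs, hdeg]) hc
  rw [hX, hA, (C.restrict (C.component c)).card_arcs, ← Set.ncard_coe_finset
    (C.ends_finite.toFinset.filter _), hY] at key
  have hconn := C.restrict_component_connected hc
  refine key.imp (fun h => ⟨⟨hconn, h.2⟩, h.1.1, fun y hy => h.1.2 ?_⟩)
    fun h => ⟨⟨hconn, h.2⟩, fun x hx => Finset.disjoint_left.1 h.1.1 hx,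
      fun y hy => Finset.disjoint_left.1 h.1.2 ?_⟩
  · rw [← hY] at hy; exact hy
  · rw [← hY] at hy; exact hy

/-- A component of the active part cannot be a tree and a dual tree at the same time. -/
theorem not_isTree_and_isDualTree (C : ResConfig k) {c : Set Sphere2}
    (hc : c ∈ C.active.circles) (ht : (C.active.restrict (C.active.component c)).IsTree)
    (hd : (C.active.restrict (C.active.component c)).IsDualTree) : False := by
  have hcl := C.active.restrict_component_isClosedIn c
  have hcT : c ∈ (C.active.restrict (C.active.component c)).circles :=
    C.active.mem_restrict_component_circles.2 ⟨hc, .refl _⟩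
  -- A single circle without arcs would be both a tree and a dual tree. An active circle carries a
  -- foot, so the component has `n ≥ 1` arcs and `n + 1 ≠ 1`.
  obtain ⟨A, hA, h⟩ := C.exists_foot_of_mem_active hc
  have hAT : A ∈ (C.active.restrict (C.active.component c)).arcs :=
    h.elim (fun h => hcl.src_closed A hA ⟨c, hcT, h⟩) fun h => hcl.tgt_closed A hA ⟨c, hcT, h⟩
  have h0 := Finset.card_pos.2 ⟨A, hAT⟩
  have h1 := (C.active.restrict (C.active.component c)).card_arcs
  have h2 := ht.2.1
  have h3 := hd.2.1
  omega

/-- There is at most one pair of monomials of the active part with non-zero coefficient. -/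
theorem eq_of_isTreePair (C : ResConfig k) {a a' b b' : Finset (Set Sphere2)}
    (ha : a ⊆ C.active.circles) (ha' : a' ⊆ C.active.circles) (hb : ∀ y ∈ b, y ∈ C.active.ends)
    (hb' : ∀ y ∈ b', y ∈ C.active.ends)
    (h : ∀ K ∈ C.active.components, (C.active.restrict K).IsTreePair a b)
    (h' : ∀ K ∈ C.active.components, (C.active.restrict K).IsTreePair a' b') :
    a = a' ∧ b = b' := by
  have key : ∀ c ∈ C.active.circles, (c ∈ a ↔ c ∈ a') ∧
      ∀ y ∈ C.active.ends, Meets c y → (y ∈ b ↔ y ∈ b') := fun c hc => by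
    have hK : C.active.component c ∈ C.active.components := C.active.mem_components.2 ⟨c, hc, rfl⟩
    have hcT := C.active.mem_restrict_component_circles.2 ⟨hc, .refl c⟩
    have hyT : ∀ y ∈ C.active.ends, Meets c y →
        y ∈ (C.active.restrict (C.active.component c)).ends := fun y hy hm =>
      C.active.mem_restrict_component_ends.2 ⟨hy, c, hc, .refl c, hm⟩
    -- The type of the component does not depend on the monomials, and it decides whether they
    -- contain all of its circles or none.
    rcases h _ hK with ⟨ht, h1, h2⟩ | ⟨hd, h1, h2⟩ <;>
      rcases h' _ hK with ⟨ht', h1', h2'⟩ | ⟨hd', h1', h2'⟩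
    · exact ⟨iff_of_true (h1 c hcT) (h1' c hcT), fun y hy hm =>
        iff_of_true (h2 y (hyT y hy hm)) (h2' y (hyT y hy hm))⟩
    · exact (C.not_isTree_and_isDualTree hc ht hd').elim
    · exact (C.not_isTree_and_isDualTree hc ht' hd).elim
    · exact ⟨iff_of_false (h1 c hcT) (h1' c hcT), fun y hy hm =>
        iff_of_false (h2 y (hyT y hy hm)) (h2' y (hyT y hy hm))⟩
  have keyY : ∀ y ∈ C.active.ends, (y ∈ b ↔ y ∈ b') := fun y hy => by
    obtain ⟨c, hc, hm⟩ := exists_circle_meets hy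
    exact (key c hc).2 y hy hm
  exact ⟨Finset.ext fun x => ⟨fun hx => (key x (ha hx)).1.1 hx, fun hx => (key x (ha' hx)).1.2 hx⟩,
    Finset.ext fun y => ⟨fun hy => (keyY y (hb y hy)).1 hy, fun hy => (keyY y (hb' y hy)).2 hy⟩⟩

theorem treeCoeff_eq_one {T : ResConfig k} {a b : Finset (Set Sphere2)} (h : T.IsTreePair a b) :
    T.treeCoeff a b = 1 := if_pos h

theorem treeCoeff_eq_zero {T : ResConfig k} {a b : Finset (Set Sphere2)}
    (h : ¬T.IsTreePair a b) : T.treeCoeff a b = 0 := if_neg h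

theorem treeCoeff_filter (T : ResConfig k) {a b : Finset (Set Sphere2)} {p q : Set Sphere2 → Prop}
    [DecidablePred p] [DecidablePred q] (hp : ∀ x ∈ T.circles, p x) (hq : ∀ y ∈ T.ends, q y) :
    T.treeCoeff (a.filter p) (b.filter q) = T.treeCoeff a b := by
  have h1 : ∀ x ∈ T.circles, (x ∈ a.filter p ↔ x ∈ a) := fun x hx => by simp [hp x hx]
  have h2 : ∀ y ∈ T.ends, (y ∈ b.filter q ↔ y ∈ b) := fun y hy => by simp [hq y hy]
  unfold treeCoeff
  congr 1
  simp +contextual only [h1, h2]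

end ResConfig

/-! ### The coefficients of the associated maps -/

namespace AssociatedMaps

variable {k : ℕ} {F : AssociatedMaps k}

/-- Half of the quantum degree `2k` is the shift built into `endDegree`; the remaining `k` is the
extremal value of the counting argument, whose closure condition is the filtration rule. -/
theorem isTreePair_of_coeff_ne_zero (hdegree : F.HasBidegree ((k : ℤ), 2 * (k : ℤ)))
    (hfiltration : F.FiltrationRule) {C : ResConfig k}
    {a : Monomials (C.circles : Set (Set Sphere2))} {b : Monomials C.ends}
    (h : F.coeff C a b ≠ 0) {K : Finset (Set Sphere2)} (hK : K ∈ C.components) :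
    (C.restrict K).IsTreePair a.1 b.1 := by
  refine C.isTreePair_of_degree (fun x hx => a.2 x hx) b.2 ?_ ?_ hK
  · rintro x hx y hy ⟨P, hPx, hPy⟩
    exact hfiltration C a b h P x (a.2 x hx) y hy hPx hPy hx
  · have := congrArg Prod.snd (hdegree C a b h)
    simp only [endDegree, startDegree, Prod.snd_sub] at this
    linarith

theorem exists_coeff_ne_zero {C : ResConfig k} (h : F C ≠ 0) : ∃ a b, F.coeff C a b ≠ 0 := by
  by_contra! hno
  refine h (Finsupp.lhom_ext fun a r => ?_)
  have h0 : F C (Finsupp.single a 1) = 0 := Finsupp.ext fun b => hno a b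
  rw [← mul_one r, ← smul_eq_mul, ← Finsupp.smul_single, map_smul, h0, smul_zero,
    LinearMap.zero_apply]

/-- On the active part, the coefficients are those of the tensor product of the tree maps. -/
theorem coeff_active_eq_prod (hdegree : F.HasBidegree ((k : ℤ), 2 * (k : ℤ)))
    (hfiltration : F.FiltrationRule) {C : ResConfig k}
    {a₁ : Monomials (C.active.circles : Set (Set Sphere2))} {b₁ : Monomials C.active.ends}
    (h₁ : F.coeff C.active a₁ b₁ ≠ 0)
    (a : Monomials (C.active.circles : Set (Set Sphere2))) (b : Monomials C.active.ends) :
    F.coeff C.active a b =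
      ∏ K ∈ C.active.components, (C.active.restrict K).treeCoeff a.1 b.1 := by
  by_cases h : ∀ K ∈ C.active.components, (C.active.restrict K).IsTreePair a.1 b.1
  -- A compatible pair is unique, so it is the pair `(a₁, b₁)` with non-zero coefficient, and the
  -- only non-zero element of `𝔽₂` is `1`.
  · obtain ⟨ha, hb⟩ := C.eq_of_isTreePair (fun x hx => a₁.2 x hx) (fun x hx => a.2 x hx) b₁.2 b.2
      (fun K hK => isTreePair_of_coeff_ne_zero hdegree hfiltration h₁ hK) h
    obtain rfl : a₁ = a := Subtype.ext ha
    obtain rfl : b₁ = b := Subtype.ext hb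
    rw [Finset.prod_eq_one fun K hK => ResConfig.treeCoeff_eq_one (h K hK)]
    exact (by decide : ∀ z : ZMod 2, z ≠ 0 → z = 1) _ h₁
  · push Not at h
    obtain ⟨K, hK, hne⟩ := h
    have h0 := ResConfig.treeCoeff_eq_zero hne
    refine Eq.trans ?_ (Finset.prod_eq_zero hK h0).symm
    by_contra h0
    exact hne (isTreePair_of_coeff_ne_zero hdegree hfiltration h0 hK)

open scoped Classical in
-- Every monomial splits into an active and a passive factor. For `b` this uses that each ending
-- circle of `C` is an ending circle of the active part or a passive circle.
theorem coeff_eq_ite (hextension : F.ExtensionRule) (C : ResConfig k)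
    (a : Monomials (C.circles : Set (Set Sphere2))) (b : Monomials C.ends) :
    F.coeff C a b = if b.1.filter (· ∈ C.passive) = a.1.filter (· ∈ C.passive) then
      F.coeff C.active
        ⟨a.1.filter (· ∈ C.active.circles), fun _ hx => (Finset.mem_filter.1 hx).2⟩
        ⟨b.1.filter (· ∈ C.active.ends), fun _ hy => (Finset.mem_filter.1 hy).2⟩ else 0 := by
  rw [hextension C ⟨a.1.filter (· ∈ C.active.circles), fun _ hx => (Finset.mem_filter.1 hx).2⟩
    ⟨b.1.filter (· ∈ C.active.ends), fun _ hy => (Finset.mem_filter.1 hy).2⟩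
    ⟨a.1.filter (· ∈ C.passive), fun _ hx => (Finset.mem_filter.1 hx).2⟩
    ⟨b.1.filter (· ∈ C.passive), fun _ hx => (Finset.mem_filter.1 hx).2⟩ a b]
  · simp only [Subtype.mk.injEq]
  · rw [← Finset.filter_or, Finset.filter_true_of_mem]
    intro x hx
    have := a.2 x hx
    by_cases hp : x ∈ C.passive
    · exact Or.inr hp
    · exact Or.inl (C.mem_active_circles.2 ⟨this, hp⟩)
  · rw [← Finset.filter_or, Finset.filter_true_of_mem]
    exact fun y hy => C.mem_active_ends_or_mem_passive (b.2 y hy)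

end AssociatedMaps

open scoped Classical in
-- The same normal form as in `AssociatedMaps.coeff_eq_ite`, which reduces the comparison to the
-- active part. The factor of a component sees only the circles of that component, so it is
-- unchanged when the passive circles are dropped.
theorem ResConfig.sssCoeff_eq_ite {k : ℕ} (C : ResConfig k)
    (a : Monomials (C.circles : Set (Set Sphere2))) (b : Monomials C.ends) :
    C.sssCoeff a b = if b.1.filter (· ∈ C.passive) = a.1.filter (· ∈ C.passive) then
      ∏ K ∈ C.active.components, (C.active.restrict K).treeCoeff
        (a.1.filter (· ∈ C.active.circles)) (b.1.filter (· ∈ C.active.ends)) else 0 := by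
  have hT : ∀ K ∈ C.active.components, (C.active.restrict K).treeCoeff a.1 b.1 =
      (C.active.restrict K).treeCoeff
        (a.1.filter (· ∈ C.active.circles)) (b.1.filter (· ∈ C.active.ends)) := fun K hK => by
    obtain ⟨c, -, rfl⟩ := C.active.mem_components.1 hK
    have hcl := C.active.restrict_component_isClosedIn c
    exact (ResConfig.treeCoeff_filter _ (q := (· ∈ C.active.ends)) (fun x hx => hcl.circles_subset hx)
      fun y hy => (hcl.mem_ends_iff.1 hy).1).symm
  unfold ResConfig.sssCoeff
  rw [Finset.prod_congr rfl hT]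
  split_ifs with h
  · refine (congrArg _ (Finset.prod_eq_one fun w hw => ?_)).trans (mul_one _)
    have := Finset.ext_iff.1 h w
    simp only [Finset.mem_filter, hw, and_true] at this
    exact if_pos this.symm
  · obtain ⟨w, hw⟩ := not_forall.1 (mt Finset.ext h)
    simp only [Finset.mem_filter] at hw
    have hwp : w ∈ C.passive := by tauto
    rw [Finset.prod_eq_zero hwp, mul_zero]
    exact if_neg (by tauto)

theorem theorem3p5 (k : ℕ) (F : AssociatedMaps k)
    (hdegree : F.HasBidegree ((k : ℤ), 2 * (k : ℤ)))
    (hnaturality : F.NaturalityRule)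
    (hdisoriented : F.DisorientedRule)
    (hduality : F.DualityRule)
    (hextension : F.ExtensionRule)
    (hfiltration : F.FiltrationRule)
    (C : ResConfig k) (hF : F C ≠ 0) :
    C.active.IsUnionOfTreesAndDualTrees ∧
      ∀ (a : Monomials (C.circles : Set (Set Sphere2))) (b : Monomials C.ends),
        F.coeff C a b = C.sssCoeff a b := by
  obtain ⟨a₀, b₀, h₀⟩ := AssociatedMaps.exists_coeff_ne_zero hF
  rw [AssociatedMaps.coeff_eq_ite hextension] at h₀
  have h₁ := (ite_ne_right_iff.1 h₀).2
  refine ⟨fun K hK => ?_, fun a b => ?_⟩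
  · exact (AssociatedMaps.isTreePair_of_coeff_ne_zero hdegree hfiltration h₁ hK).imp
      And.left And.left
  · rw [AssociatedMaps.coeff_eq_ite hextension, C.sssCoeff_eq_ite]
    congr 1
    exact AssociatedMaps.coeff_active_eq_prod hdegree hfiltration h₁ _ _
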